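/- A two-way deterministic $k$-counter automaton (2D$k$CA) over a finite alphabet $\Sigma$ has a finite state set with an initial state, an accepting state and a (different) rejecting state, a two-way read-only head on the tape that carries the input $w$ between two end-markers, and $k$ counters storing integers. In each step, depending on the state, the scanned symbol and, for each counter, whether its value is zero, it changes its state, moves the head by at most one square (never beyond the end-markers), and adds $-1$, $0$ or $+1$ to each counter. It starts in the initial state with the head on the left end-marker and all counters zero, and it stops on entering the accepting or the rejecting state, accepting $w$ in the former case. It recognizes $L\subseteq\Sigma^*$ if it accepts exactly the strings in $L$. Its counters are linearly bounded if, during the computation on any input $w$, their absolute values stay $O(|w|)$, that is, at most $C(|w|+1)$ for a constant $C$ that does not depend on $w$. Theorem 1. If a unary language $L\subseteq\{a\}^*$ is recognized by a 2D2CA whose counters are linearly bounded, then $\{a^{42^n} \mid n\ge 0,\ a^n\in L\}$ is recognized by a 2D1CA. Moreover, $\{a^{42^{n^2}} \mid n\ge 0\}$ and $\{a^{42^p} \mid p \text{ is a prime}\}$ are recognized by 2D1CAs. -/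

import Mathlib

/-- The tape alphabet: the input letters together with the two end-markers. -/
inductive TapeSymbol (α : Type) where
  | leftEnd : TapeSymbol α
  | letter (a : α) : TapeSymbol α
  | rightEnd : TapeSymbol α

/-- The possible moves of the input head. -/
inductive HeadMove where
  | left
  | stay
  | right

/-- The two observable states of a counter. -/
inductive CounterStatus where
  | zero
  | nonzero

/-- What the automaton can observe of a counter that stores the integer `v`. -/
def counterStatus (v : ℤ) : CounterStatus :=
  if v = 0 then CounterStatus.zero else CounterStatus.nonzero

/-- A two-way deterministic automaton with `k` counters (2DkCA) over the input alphabet `α`.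
In one step it reads its state, the scanned tape symbol and the status of every counter; it then
changes its state, moves the head by at most one square, and adds `-1`, `0` or `1` (an element of
`SignType`) to every counter.  The values of `trans` at the two halting states are never used. -/
structure CounterAutomaton (k : ℕ) (α : Type) where
  /-- the set of states -/
  State : Type
  finite_state : Finite State
  /-- the initial state -/
  start : State
  /-- the accepting state -/
  accept : State
  /-- the rejecting state -/
  reject : State
  accept_ne_reject : accept ≠ reject
  /-- the transition function -/
  trans : State → TapeSymbol α → (Fin k → CounterStatus) → State × HeadMove × (Fin k → SignType)
  /-- the head never moves to the left from the left end-marker -/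
  trans_leftEnd : ∀ s θ, (trans s TapeSymbol.leftEnd θ).2.1 ≠ HeadMove.left
  /-- the head never moves to the right from the right end-marker -/
  trans_rightEnd : ∀ s θ, (trans s TapeSymbol.rightEnd θ).2.1 ≠ HeadMove.right

/-- The content of square `i` of the tape on which `w` is written between the end-markers: the left
end-marker is in square `0`, the letters of `w` are in the squares `1, …, |w|`, and the right
end-marker is in square `|w| + 1`. -/
def tapeSymbolAt {α : Type} (w : List α) : ℕ → TapeSymbol α
  | 0 => TapeSymbol.leftEnd
  | i + 1 =>
    match w[i]? with
    | some a => TapeSymbol.letter a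
    | none => TapeSymbol.rightEnd

/-- The head position after a move. -/
def HeadMove.apply : HeadMove → ℕ → ℕ
  | HeadMove.left, i => i - 1
  | HeadMove.stay, i => i
  | HeadMove.right, i => i + 1

namespace CounterAutomaton

variable {k : ℕ} {α : Type}

/-- A configuration: the state, the head position, and the values of the counters. -/
structure Config (M : CounterAutomaton k α) where
  state : M.State
  pos : ℕ
  counter : Fin k → ℤ

/-- The initial configuration: the initial state, the head on the left end-marker, and all counters
equal to zero. -/
def initial (M : CounterAutomaton k α) : M.Config :=
  ⟨M.start, 0, fun _ => 0⟩

/-- The result of applying the transition function to a configuration on the input `w`. -/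
def next (M : CounterAutomaton k α) (w : List α) (c : M.Config) : M.Config :=
  let t := M.trans c.state (tapeSymbolAt w c.pos) (fun j => counterStatus (c.counter j))
  ⟨t.1, t.2.1.apply c.pos, fun j => c.counter j + (t.2.2 j : ℤ)⟩

/-- One step of the computation on `w`; the computation ends in the two halting states. -/
def Step (M : CounterAutomaton k α) (w : List α) (c d : M.Config) : Prop :=
  c.state ≠ M.accept ∧ c.state ≠ M.reject ∧ d = M.next w c

/-- The configuration `c` occurs in the computation on the input `w`. -/
def Reaches (M : CounterAutomaton k α) (w : List α) (c : M.Config) : Prop :=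
  Relation.ReflTransGen (M.Step w) M.initial c

/-- `M` accepts `w`: the computation on `w` enters the accepting state. -/
def Accepts (M : CounterAutomaton k α) (w : List α) : Prop :=
  ∃ c : M.Config, M.Reaches w c ∧ c.state = M.accept

/-- `M` recognizes `L`: it accepts exactly the strings in `L`. -/
def Recognizes (M : CounterAutomaton k α) (L : Language α) : Prop :=
  ∀ w : List α, w ∈ L ↔ M.Accepts w

/-- All counters of `M` are linearly bounded: throughout the computation on any input `w`, their
values are `O(|w|)` in absolute value.  The summand `1` only makes room for the empty input. -/
def LinearlyBounded (M : CounterAutomaton k α) : Prop :=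
  ∃ C : ℕ, ∀ (w : List α) (c : M.Config), M.Reaches w c →
    ∀ j : Fin k, |c.counter j| ≤ (C : ℤ) * ((w.length : ℤ) + 1)

end CounterAutomaton

/-- The language `L` is recognized by a two-way deterministic one-counter automaton. -/
def RecognizedBy2D1CA {α : Type} (L : Language α) : Prop :=
  ∃ M : CounterAutomaton 1 α, M.Recognizes L

/-- The language `L` is recognized by a two-way deterministic two-counter automaton whose counters
are linearly bounded. -/
def RecognizedByLinearlyBounded2D2CA {α : Type} (L : Language α) : Prop :=
  ∃ M : CounterAutomaton 2 α, M.LinearlyBounded ∧ M.Recognizes L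

/-- The string `a^n` over the one-letter alphabet `{a}`, which is modelled by `Unit`. -/
def unaryWord (n : ℕ) : List Unit :=
  List.replicate n ()

/-! On an input of length N, one counter can act as a register that is multiplied by fixed
fractions. Emptying the counter turns it into a quotient, held by the head position, and a
remainder, held by the state; on the way back to the left end-marker the counter is refilled by a
constant amount per square. This works as long as the register is O(N) (`reg_scale`).

For N = 42^n the register can store 2^i * 3^(n-i) * 5^x * 7^y, which codes a configuration on a^n: i
is the head position, the exponent of 3 reveals the right end, and x, y carry the counters. A step
of the two-counter automaton multiplies the register by a fraction, and the residue modulo 210 =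
2*3*5*7 tells which exponents vanish. Since the counters are at most C(n+1) in absolute value,
keeping their signs and last digits in base 2C+2 in the state leaves x, y ≤ n/2. Hence 5^x, 7^y ≤
9^(n/2) = 3^n, and the register stays below 27^n ≤ 42^n (`regCode_le`). Repeated division by 42
checks the input length; removing the factors 14 from 42^n leaves 3^n, the code of the initial
configuration. `acceptsFrom_iff_of_simulation` transfers acceptance.

For squares and primes it then suffices to give linearly bounded two-counter automata. -/

/-! ### Tape symbols and unary words -/

theorem tapeSymbolAt_zero {α : Type} (w : List α) : tapeSymbolAt w 0 = TapeSymbol.leftEnd := rfl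

theorem tapeSymbolAt_of_length_lt {α : Type} {w : List α} {p : ℕ} (h : w.length < p) :
    tapeSymbolAt w p = TapeSymbol.rightEnd := by
  obtain ⟨p, rfl⟩ : ∃ q, p = q + 1 := ⟨p - 1, by omega⟩
  have : w[p]? = none := List.getElem?_eq_none (by omega)
  simp [tapeSymbolAt, this]

theorem tapeSymbolAt_unary {w : List Unit} {p : ℕ} (h : 0 < p) (h' : p ≤ w.length) :
    tapeSymbolAt w p = TapeSymbol.letter () := by
  obtain ⟨p, rfl⟩ : ∃ q, p = q + 1 := ⟨p - 1, by omega⟩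
  have : w[p]? = some () := List.getElem?_eq_getElem (by omega)
  simp [tapeSymbolAt, this]

theorem counterStatus_zero : counterStatus 0 = CounterStatus.zero := by simp [counterStatus]

theorem counterStatus_of_ne {v : ℤ} (h : v ≠ 0) : counterStatus v = CounterStatus.nonzero := by
  simp [counterStatus, h]

theorem eq_unaryWord_length (w : List Unit) : w = unaryWord w.length :=
  List.eq_replicate_of_mem fun _ _ => rfl

@[simp] theorem length_unaryWord (n : ℕ) : (unaryWord n).length = n := by simp [unaryWord]

theorem eq_unaryWord_iff {w : List Unit} {n : ℕ} : w = unaryWord n ↔ w.length = n :=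
  ⟨fun h => by rw [h, length_unaryWord], fun h => by rw [← h]; exact eq_unaryWord_length w⟩

/-! ### Deterministic computations: simulation and invariants -/

namespace CounterAutomaton

variable {k l : ℕ} {α β : Type}

/-- The computation that starts at the configuration `c` enters the accepting state. -/
def AcceptsFrom (M : CounterAutomaton k α) (w : List α) (c : M.Config) : Prop :=
  ∃ d : M.Config, Relation.ReflTransGen (M.Step w) c d ∧ d.state = M.accept

theorem accepts_iff_acceptsFrom (M : CounterAutomaton k α) (w : List α) :
    M.Accepts w ↔ M.AcceptsFrom w M.initial := Iff.rfl

theorem Step.unique {M : CounterAutomaton k α} {w : List α} {c d e : M.Config}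
    (h : M.Step w c d) (h' : M.Step w c e) : d = e := h.2.2.trans h'.2.2.symm

theorem acceptsFrom_of_accept {M : CounterAutomaton k α} {w : List α} {c : M.Config}
    (h : c.state = M.accept) : M.AcceptsFrom w c := ⟨c, .refl, h⟩

theorem not_acceptsFrom_of_reject {M : CounterAutomaton k α} {w : List α} {c : M.Config}
    (h : c.state = M.reject) : ¬ M.AcceptsFrom w c := by
  rintro ⟨d, hd, hacc⟩
  rcases hd.cases_head with rfl | ⟨e, he, -⟩
  · exact M.accept_ne_reject (hacc.symm.trans h)
  · exact he.2.1 h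

theorem acceptsFrom_iff_of_step {M : CounterAutomaton k α} {w : List α} {c d : M.Config}
    (h : M.Step w c d) : M.AcceptsFrom w c ↔ M.AcceptsFrom w d := by
  constructor
  · rintro ⟨e, he, hacc⟩
    rcases he.cases_head with rfl | ⟨f, hf, hfe⟩
    · exact absurd hacc h.1
    · exact ⟨e, h.unique hf ▸ hfe, hacc⟩
  · rintro ⟨e, he, hacc⟩
    exact ⟨e, .head h he, hacc⟩

theorem acceptsFrom_iff_of_reaches {M : CounterAutomaton k α} {w : List α} {c d : M.Config}
    (h : Relation.ReflTransGen (M.Step w) c d) : M.AcceptsFrom w c ↔ M.AcceptsFrom w d := by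
  induction h with
  | refl => rfl
  | tail _ h ih => exact ih.trans (acceptsFrom_iff_of_step h)

/-- By determinism the accepting run is the only run, and it is finite. -/
theorem acc_of_acceptsFrom {M : CounterAutomaton k α} {w : List α} {c : M.Config}
    (h : M.AcceptsFrom w c) : Acc (fun x y => M.Step w y x) c := by
  obtain ⟨d, hd, hacc⟩ := h
  induction hd using Relation.ReflTransGen.head_induction_on with
  | refl => exact ⟨_, fun e he => absurd hacc he.1⟩
  | head h _ ih => exact ⟨_, fun e he => h.unique he ▸ ih⟩

/-- If every step of `M` is matched by at least one step of `N`, and halting configurations of `M`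
accept exactly when the matching configurations of `N` do, then `M` and `N` accept from matching
configurations alike. -/
theorem acceptsFrom_iff_of_simulation {M : CounterAutomaton k α} {N : CounterAutomaton l β}
    {v : List α} {w : List β} (r : M.Config → N.Config → Prop)
    (step : ∀ c d c', r c d → M.Step v c c' →
      ∃ d', r c' d' ∧ Relation.TransGen (N.Step w) d d')
    (accept : ∀ c d, r c d → c.state = M.accept → N.AcceptsFrom w d)
    (reject : ∀ c d, r c d → c.state = M.reject → ¬ N.AcceptsFrom w d)
    {c : M.Config} {d : N.Config} (h : r c d) :
    M.AcceptsFrom v c ↔ N.AcceptsFrom w d := by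
  constructor
  · rintro ⟨e, he, hacc⟩
    induction he using Relation.ReflTransGen.head_induction_on generalizing d with
    | refl => exact accept _ _ h hacc
    | head h₁ _ ih =>
      obtain ⟨d', hr, hd⟩ := step _ _ _ h h₁
      exact (acceptsFrom_iff_of_reaches hd.to_reflTransGen).2 (ih hr)
  · intro hd
    -- Each step of `M` consumes at least one step of the finite run of `N`, so `M` must halt as
    -- well; the induction is along that run.
    have hacc := (acc_of_acceptsFrom hd).transGen
    induction hacc generalizing c with
    | intro d _ ih =>
      by_cases h₁ : c.state = M.accept
      · exact acceptsFrom_of_accept h₁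
      by_cases h₂ : c.state = M.reject
      · exact absurd hd (reject _ _ h h₂)
      have hs : M.Step v c (M.next v c) := ⟨h₁, h₂, rfl⟩
      obtain ⟨d', hr, hdd⟩ := step _ _ _ h hs
      refine (acceptsFrom_iff_of_step hs).2 (ih d' ?_ hr ?_)
      · exact Relation.transGen_swap.1 hdd
      · exact (acceptsFrom_iff_of_reaches hdd.to_reflTransGen).1 hd

/-- The decrease of the index plays no role here; the hypothesis has this form so that one step
lemma yields both the counter bound and the decision of acceptance. -/
theorem reaches_of_invariant {M : CounterAutomaton k α} {w : List α} {μ : Type} [LT μ]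
    {I : μ → M.Config → Prop} {t₀ : μ} (init : I t₀ M.initial)
    (step : ∀ t c, I t c → c.state ≠ M.accept → c.state ≠ M.reject →
      ∃ t' < t, I t' (M.next w c))
    {c : M.Config} (h : M.Reaches w c) : ∃ t, I t c := by
  induction h with
  | refl => exact ⟨_, init⟩
  | tail _ h ih =>
    obtain ⟨t, ht⟩ := ih
    obtain ⟨t', -, ht'⟩ := step t _ ht h.1 h.2.1
    exact ⟨t', h.2.2 ▸ ht'⟩

/-- An invariant that is indexed by a decreasing measure decides acceptance. -/
theorem accepts_iff_of_invariant {M : CounterAutomaton k α} {w : List α} {μ : Type} [LT μ]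
    [WellFoundedLT μ] {I : μ → M.Config → Prop} {t₀ : μ} (init : I t₀ M.initial)
    (step : ∀ t c, I t c → c.state ≠ M.accept → c.state ≠ M.reject →
      ∃ t' < t, I t' (M.next w c))
    {P : Prop} (accept : ∀ t c, I t c → c.state = M.accept → P)
    (reject : ∀ t c, I t c → c.state = M.reject → ¬ P) : M.Accepts w ↔ P := by
  constructor
  · rintro ⟨c, hc, hacc⟩
    obtain ⟨t, ht⟩ := reaches_of_invariant init step hc
    exact accept t c ht hacc
  · intro hP
    suffices H : ∀ t c, I t c → M.AcceptsFrom w c from H _ _ init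
    intro t
    induction t using WellFoundedLT.induction with
    | ind t ih =>
      intro c hc
      by_cases h₁ : c.state = M.accept
      · exact acceptsFrom_of_accept h₁
      have h₂ : c.state ≠ M.reject := fun h => reject t c hc h hP
      obtain ⟨t', ht', hI⟩ := step t c hc h₁ h₂
      exact (acceptsFrom_iff_of_step ⟨h₁, h₂, rfl⟩).2 (ih t' ht' _ hI)

end CounterAutomaton

/-! ### A two-counter automaton for squares -/

/-- The states of `squareAutomaton`. -/
inductive SquareState where
  | test
  | forth
  | back
  | accept
  | reject
  deriving DecidableEq

instance : Finite SquareState :=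
  @Finite.of_fintype _ (Fintype.ofList [.test, .forth, .back, .accept, .reject]
    fun s => by cases s <;> simp)

/-- A two-counter automaton that recognizes the strings whose length is a square: its head visits
the squares `k ^ 2 + 1` of the tape one after the other. -/
def squareAutomaton : CounterAutomaton 2 Unit where
  State := SquareState
  finite_state := inferInstance
  start := .forth
  accept := .accept
  reject := .reject
  accept_ne_reject := by decide
  trans s a θ :=
    match s, a, θ 0, θ 1 with
    | .test, .rightEnd, _, _ => (.accept, .stay, 0)
    | .test, _, _, _ => (.forth, .right, 0)
    | .forth, .rightEnd, .nonzero, _ => (.reject, .stay, 0)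
    -- This happens only in the first step; it leads to square 0 ^ 2 + 1 with k = 0.
    | .forth, .leftEnd, _, _ => (.test, .right, 0)
    | .forth, _, .nonzero, _ => (.forth, .right, ![-1, 1])
    | .forth, _, .zero, _ => (.back, .stay, 0)
    | .back, .rightEnd, _, .nonzero => (.reject, .stay, 0)
    | .back, _, _, .nonzero => (.back, .right, ![1, -1])
    -- One move from `test`, k moves forth and k moves back lead from square k ^ 2 + 1 to square (k
    -- + 1) ^ 2 + 1.
    | .back, _, _, .zero => (.test, .stay, ![1, 0])
    | .accept, _, _, _ => (.accept, .stay, 0)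
    | .reject, _, _, _ => (.reject, .stay, 0)
  trans_leftEnd s θ := by
    cases s <;> cases θ 0 <;> cases θ 1 <;> simp
  trans_rightEnd s θ := by
    cases s <;> cases θ 0 <;> cases θ 1 <;> simp

theorem config_eq {α : Type} {M : CounterAutomaton 2 α} {s : M.State} {p q : ℕ}
    {f g : Fin 2 → ℤ} (hp : p = q) (h₀ : f 0 = g 0) (h₁ : f 1 = g 1) :
    (⟨s, p, f⟩ : M.Config) = ⟨s, q, g⟩ := by
  have : f = g := by
    funext j
    fin_cases j
    · exact h₀
    · exact h₁
  rw [hp, this]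

/-- The configurations of `squareAutomaton` on an input of length `n`, together with a measure
that decreases in every step. -/
inductive SquareInvariant (n : ℕ) : ℕ → squareAutomaton.Config → Prop
  | init : SquareInvariant n (4 * n + 15) ⟨.forth, 0, fun _ => 0⟩
  | test (k m : ℕ) (h : k ^ 2 + m = n) :
      SquareInvariant n (4 * m + 1) ⟨.test, k ^ 2 + 1, ![(k : ℤ), 0]⟩
  | forth (x y m : ℕ) (h : (x + y) ^ 2 + 2 + y + m = n + 1) :
      SquareInvariant n (4 * m + 3) ⟨.forth, (x + y) ^ 2 + 2 + y, ![(x : ℤ), y]⟩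
  | back (x y m : ℕ) (h : (x + y) ^ 2 + 2 + (x + y) + x + m = n + 1) :
      SquareInvariant n (4 * m + 2) ⟨.back, (x + y) ^ 2 + 2 + (x + y) + x, ![(x : ℤ), y]⟩
  | accept (p x : ℕ) (h : x ^ 2 = n) : SquareInvariant n 0 ⟨.accept, p, ![(x : ℤ), 0]⟩
  | reject (p x y : ℕ) (hx : x + y ≤ n) (h : ∀ z : ℕ, z ^ 2 ≠ n) :
      SquareInvariant n 0 ⟨.reject, p, ![(x : ℤ), y]⟩

theorem sq_ne_of_lt_of_lt {n k : ℕ} (h : k ^ 2 < n) (h' : n < (k + 1) ^ 2) (z : ℕ) : z ^ 2 ≠ n := by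
  rintro rfl
  have h₁ := lt_of_pow_lt_pow_left₀ 2 (by omega) h
  have h₂ := lt_of_pow_lt_pow_left₀ 2 (by omega) h'
  omega

/-- Here m is the distance to the right end-marker. A move to the right lowers 4 * m, and the
stationary changes forth, back, test descend through the weights 3, 2, 1. Rejection is correct
because the end-marker then lies strictly between the squares k ^ 2 + 1 and (k + 1) ^ 2 + 1. -/
theorem SquareInvariant.step {w : List Unit} {t : ℕ} {c : squareAutomaton.Config}
    (h : SquareInvariant w.length t c) (ha : c.state ≠ squareAutomaton.accept)
    (hr : c.state ≠ squareAutomaton.reject) :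
    ∃ t' < t, SquareInvariant w.length t' (squareAutomaton.next w c) := by
  cases h with
  | init =>
    refine ⟨4 * w.length + 1, by omega, ?_⟩
    convert SquareInvariant.test (n := w.length) 0 w.length (by simp) using 1
    simp only [CounterAutomaton.next, squareAutomaton, tapeSymbolAt_zero, HeadMove.apply]
    exact config_eq (by omega) (by simp) (by simp)
  | test k m h =>
    rcases Nat.eq_zero_or_pos m with rfl | hm
    · refine ⟨0, by omega, ?_⟩
      convert SquareInvariant.accept (n := w.length) (k ^ 2 + 1) k (by omega) using 1
      simp only [CounterAutomaton.next, squareAutomaton,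
        tapeSymbolAt_of_length_lt (show w.length < k ^ 2 + 1 by omega), HeadMove.apply]
      exact config_eq (by omega) (by simp) (by simp)
    · refine ⟨4 * (m - 1) + 3, by omega, ?_⟩
      convert SquareInvariant.forth (n := w.length) k 0 (m - 1) (by simp; omega) using 1
      simp only [CounterAutomaton.next, squareAutomaton,
        tapeSymbolAt_unary (show 0 < k ^ 2 + 1 by omega) (show k ^ 2 + 1 ≤ w.length by omega),
        HeadMove.apply]
      exact config_eq (by simp) (by simp) (by simp)
  | forth x y m h =>
    rcases Nat.eq_zero_or_pos x with rfl | hx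
    · refine ⟨4 * m + 2, by omega, ?_⟩
      convert SquareInvariant.back (n := w.length) 0 y m (by omega) using 1
      rcases Nat.eq_zero_or_pos m with rfl | hm
      · simp only [CounterAutomaton.next, squareAutomaton,
          tapeSymbolAt_of_length_lt (show w.length < (0 + y) ^ 2 + 2 + y by omega),
          HeadMove.apply, Matrix.cons_val_zero, Nat.cast_zero, counterStatus_zero]
        simp
      · simp only [CounterAutomaton.next, squareAutomaton,
          tapeSymbolAt_unary (show 0 < (0 + y) ^ 2 + 2 + y by omega)
            (show (0 + y) ^ 2 + 2 + y ≤ w.length by omega),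
          HeadMove.apply, Matrix.cons_val_zero, Nat.cast_zero, counterStatus_zero]
        simp
    · have hx' : (x : ℤ) ≠ 0 := by omega
      rcases Nat.eq_zero_or_pos m with rfl | hm
      · refine ⟨0, by omega, ?_⟩
        have hk : x + y ≤ (x + y) ^ 2 := Nat.le_self_pow (by omega) _
        convert SquareInvariant.reject (n := w.length) ((x + y) ^ 2 + 2 + y) x y (by omega)
          (sq_ne_of_lt_of_lt (k := x + y) (by omega) (by ring_nf at h ⊢; omega)) using 1
        simp only [CounterAutomaton.next, squareAutomaton,
          tapeSymbolAt_of_length_lt (show w.length < (x + y) ^ 2 + 2 + y by omega),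
          HeadMove.apply, Matrix.cons_val_zero, counterStatus_of_ne hx']
        simp
      · refine ⟨4 * (m - 1) + 3, by omega, ?_⟩
        obtain ⟨x, rfl⟩ : ∃ x', x = x' + 1 := ⟨x - 1, by omega⟩
        have e : x + (y + 1) = x + 1 + y := by omega
        convert SquareInvariant.forth (n := w.length) x (y + 1) (m - 1) (by rw [e]; omega) using 1
        simp only [CounterAutomaton.next, squareAutomaton,
          tapeSymbolAt_unary (show 0 < (x + 1 + y) ^ 2 + 2 + y by omega)
            (show (x + 1 + y) ^ 2 + 2 + y ≤ w.length by omega),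
          HeadMove.apply, Matrix.cons_val_zero, counterStatus_of_ne hx', e]
        exact config_eq (by omega) (by simp) (by simp)
  | back x y m h =>
    rcases Nat.eq_zero_or_pos y with rfl | hy
    · refine ⟨4 * m + 1, by omega, ?_⟩
      have e : (x + 0) ^ 2 + 2 + (x + 0) + x = (x + 1) ^ 2 + 1 := by ring
      rw [e] at h ⊢
      convert SquareInvariant.test (n := w.length) (x + 1) m (by omega) using 1
      rcases Nat.eq_zero_or_pos m with rfl | hm
      · simp only [CounterAutomaton.next, squareAutomaton,
          tapeSymbolAt_of_length_lt (show w.length < (x + 1) ^ 2 + 1 by omega),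
          HeadMove.apply, Matrix.cons_val_one, Matrix.cons_val_zero, Nat.cast_zero,
          counterStatus_zero]
        exact config_eq (by omega) (by simp) (by simp)
      · simp only [CounterAutomaton.next, squareAutomaton,
          tapeSymbolAt_unary (show 0 < (x + 1) ^ 2 + 1 by omega)
            (show (x + 1) ^ 2 + 1 ≤ w.length by omega),
          HeadMove.apply, Matrix.cons_val_one, Matrix.cons_val_zero, Nat.cast_zero,
          counterStatus_zero]
        exact config_eq (by omega) (by simp) (by simp)
    · have hy' : (y : ℤ) ≠ 0 := by omega
      rcases Nat.eq_zero_or_pos m with rfl | hm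
      · refine ⟨0, by omega, ?_⟩
        convert SquareInvariant.reject (n := w.length) ((x + y) ^ 2 + 2 + (x + y) + x) x y
          (by omega)
          (sq_ne_of_lt_of_lt (k := x + y) (by omega) (by ring_nf at h ⊢; omega)) using 1
        simp only [CounterAutomaton.next, squareAutomaton,
          tapeSymbolAt_of_length_lt (show w.length < (x + y) ^ 2 + 2 + (x + y) + x by omega),
          HeadMove.apply, Matrix.cons_val_one, Matrix.cons_val_zero, counterStatus_of_ne hy']
        simp
      · refine ⟨4 * (m - 1) + 2, by omega, ?_⟩
        obtain ⟨y, rfl⟩ : ∃ y', y = y' + 1 := ⟨y - 1, by omega⟩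
        have e : x + 1 + y = x + (y + 1) := by omega
        convert SquareInvariant.back (n := w.length) (x + 1) y (m - 1) (by rw [e]; omega) using 1
        simp only [CounterAutomaton.next, squareAutomaton,
          tapeSymbolAt_unary (show 0 < (x + (y + 1)) ^ 2 + 2 + (x + (y + 1)) + x by omega)
            (show (x + (y + 1)) ^ 2 + 2 + (x + (y + 1)) + x ≤ w.length by omega),
          HeadMove.apply, Matrix.cons_val_one, Matrix.cons_val_zero, counterStatus_of_ne hy', e]
        exact config_eq (by omega) (by simp) (by simp)
  | accept => exact absurd rfl ha
  | reject => exact absurd rfl hr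

theorem SquareInvariant.initial (n : ℕ) :
    SquareInvariant n (4 * n + 15) squareAutomaton.initial := .init

theorem SquareInvariant.abs_counter_le {n t : ℕ} {c : squareAutomaton.Config}
    (h : SquareInvariant n t c) (j : Fin 2) : |c.counter j| ≤ n + 1 := by
  cases h with
  | init => simp; omega
  | test k m h =>
    have : k ≤ k ^ 2 := Nat.le_self_pow (by omega) _
    fin_cases j <;> simp <;> omega
  | forth x y m h =>
    have : x + y ≤ (x + y) ^ 2 := Nat.le_self_pow (by omega) _
    fin_cases j <;> simp <;> omega
  | back x y m h =>
    have : x + y ≤ (x + y) ^ 2 := Nat.le_self_pow (by omega) _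
    fin_cases j <;> simp <;> omega
  | accept p k h =>
    have : k ≤ k ^ 2 := Nat.le_self_pow (by omega) _
    fin_cases j <;> simp <;> omega
  | reject p x y hx h => fin_cases j <;> simp <;> omega

theorem recognizedByLinearlyBounded2D2CA_squares :
    RecognizedByLinearlyBounded2D2CA
      ({w | ∃ n : ℕ, w = unaryWord (n ^ 2)} : Language Unit) := by
  refine ⟨squareAutomaton, ⟨1, fun w c hc j => ?_⟩, fun w => ?_⟩
  · obtain ⟨t, ht⟩ := CounterAutomaton.reaches_of_invariant (SquareInvariant.initial w.length)
      (fun _ _ h => h.step) hc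
    simpa using ht.abs_counter_le j
  · refine Iff.trans ?_ (CounterAutomaton.accepts_iff_of_invariant
      (P := ∃ z : ℕ, w.length = z ^ 2) (SquareInvariant.initial w.length)
      (fun _ _ h => h.step) ?_ ?_).symm
    · exact exists_congr fun _ => eq_unaryWord_iff
    · rintro t c (_ | _ | _ | _ | ⟨p, x, h⟩ | _) ha
      case accept => exact ⟨x, h.symm⟩
      all_goals cases ha
    · rintro t c (_ | _ | _ | _ | _ | ⟨p, x, y, hx, h⟩) hr
      case reject => exact fun ⟨z, hz⟩ => h z hz.symm
      all_goals cases hr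

/-! ### A two-counter automaton for primes -/

/-- The states of `primeAutomaton`. -/
inductive PrimeState where
  | start
  | first
  | give
  | take
  | back
  | accept
  | reject
  deriving DecidableEq

instance : Finite PrimeState :=
  @Finite.of_fintype _ (Fintype.ofList [.start, .first, .give, .take, .back, .accept, .reject]
    fun s => by cases s <;> simp)

/-- A two-counter automaton that recognizes the strings of prime length `n`: it tries the divisors
`2, 3, …` of `n`, the current one being the sum of the two counters. -/
def primeAutomaton : CounterAutomaton 2 Unit where
  State := PrimeState
  finite_state := inferInstance
  start := .start
  accept := .accept
  reject := .reject
  accept_ne_reject := by decide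
  trans s a θ :=
    match s, a, θ 0, θ 1 with
    -- The divisor 1 counts as already tried; `back` raises it to 2 on the left end-marker.
    | .start, _, _, _ => (.back, .stay, ![1, 0])
    | .first, .rightEnd, .zero, _ => (.accept, .stay, 0)
    | .first, .rightEnd, .nonzero, _ => (.reject, .stay, 0)
    | .first, _, .nonzero, _ => (.first, .right, ![-1, 1])
    | .first, _, .zero, _ => (.give, .stay, 0)
    | .give, .rightEnd, _, .zero => (.reject, .stay, 0)
    | .give, .rightEnd, _, .nonzero => (.back, .stay, 0)
    | .give, _, _, .nonzero => (.give, .right, ![1, -1])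
    | .give, _, _, .zero => (.take, .stay, 0)
    | .take, .rightEnd, .zero, _ => (.reject, .stay, 0)
    | .take, .rightEnd, .nonzero, _ => (.back, .stay, 0)
    | .take, _, .nonzero, _ => (.take, .right, ![-1, 1])
    | .take, _, .zero, _ => (.give, .stay, 0)
    | .back, .leftEnd, _, _ => (.first, .right, ![1, 0])
    | .back, _, _, .nonzero => (.back, .left, ![1, -1])
    | .back, _, _, .zero => (.back, .left, 0)
    | .accept, _, _, _ => (.accept, .stay, 0)
    | .reject, _, _, _ => (.reject, .stay, 0)
  trans_leftEnd s θ := by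
    cases s <;> cases θ 0 <;> cases θ 1 <;> simp
  trans_rightEnd s θ := by
    cases s <;> cases θ 0 <;> cases θ 1 <;> simp

/-- The configurations of `primeAutomaton` on an input of length `n`, together with a measure
that decreases in every step. -/
inductive PrimeInvariant (n : ℕ) : ℕ ×ₗ ℕ → primeAutomaton.Config → Prop
  | start : PrimeInvariant n (toLex (n + 4, 0)) ⟨.start, 0, fun _ => 0⟩
  | first (x y m : ℕ) (h : y + m = n) (hd : 2 ≤ x + y) (hn : x + y ≤ 2 ∨ x + y ≤ n)
      (hdvd : ∀ e, 2 ≤ e → e < x + y → ¬ e ∣ n) :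
      PrimeInvariant n (toLex (n + 3 - (x + y), n + 6 + 2 * m + if x = 0 then 1 else 0))
        ⟨.first, y + 1, ![(x : ℤ), y]⟩
  | give (x y q m : ℕ) (h : (x + y) * q + x + m = n) (hd : 2 ≤ x + y) (hq : 0 < q)
      (hn : (x + y) * q < n) (hdvd : ∀ e, 2 ≤ e → e < x + y → ¬ e ∣ n) :
      PrimeInvariant n (toLex (n + 3 - (x + y), n + 5 + 2 * m + if y = 0 then 1 else 0))
        ⟨.give, (x + y) * q + x + 1, ![(x : ℤ), y]⟩
  | take (x y q m : ℕ) (h : (x + y) * q + y + m = n) (hd : 2 ≤ x + y) (hq : 0 < q)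
      (hn : (x + y) * q < n) (hdvd : ∀ e, 2 ≤ e → e < x + y → ¬ e ∣ n) :
      PrimeInvariant n (toLex (n + 3 - (x + y), n + 5 + 2 * m + if x = 0 then 1 else 0))
        ⟨.take, (x + y) * q + y + 1, ![(x : ℤ), y]⟩
  | back (x y p : ℕ) (hy : y ≤ p) (hp : p ≤ n + 1) (hd : 1 ≤ x + y) (hn : x + y ≤ 1 ∨ x + y < n)
      (hdvd : ∀ e, 2 ≤ e → e ≤ x + y → ¬ e ∣ n) :
      PrimeInvariant n (toLex (n + 3 - (x + y), p + 1)) ⟨.back, p, ![(x : ℤ), y]⟩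
  | accept (p x y : ℕ) (hx : x + y ≤ n + 2) (h : n.Prime) :
      PrimeInvariant n (toLex (0, 0)) ⟨.accept, p, ![(x : ℤ), y]⟩
  | reject (p x y : ℕ) (hx : x + y ≤ n + 2) (h : ¬ n.Prime) :
      PrimeInvariant n (toLex (0, 0)) ⟨.reject, p, ![(x : ℤ), y]⟩

theorem not_prime_of_eq_mul {n d q : ℕ} (h : d * q + d = n) (hd : 2 ≤ d) (hq : 0 < q) :
    ¬ n.Prime := by
  intro hn
  have h' : n = d * (q + 1) := by rw [← h]; ring
  exact Nat.not_prime_mul (by omega) (by omega) (h' ▸ hn)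

theorem not_dvd_of_eq_mul_add {n d q r : ℕ} (h : d * q + r = n) (hr : 0 < r) (hd : r < d) :
    ¬ d ∣ n := by
  rintro hdvd
  have := (Nat.dvd_add_right (Dvd.intro q rfl)).1 (h ▸ hdvd)
  exact absurd (Nat.le_of_dvd hr this) (by omega)

theorem PrimeInvariant.exists_lt {n : ℕ} {s t : ℕ ×ₗ ℕ} {c d : primeAutomaton.Config}
    (h : PrimeInvariant n t c) (hd : d = c) (ht : t < s) : ∃ t' < s, PrimeInvariant n t' d :=
  ⟨t, ht, hd ▸ h⟩

/-- The first component drops when the divisor grows. For a fixed divisor, 2 * m drops along the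
scan and leaves room for the extra 1 that pays for a stationary change of phase; the offsets n + 5
and n + 6 keep the scan above the return sweep. -/
theorem PrimeInvariant.step {w : List Unit} {t : ℕ ×ₗ ℕ} {c : primeAutomaton.Config}
    (h : PrimeInvariant w.length t c) (ha : c.state ≠ primeAutomaton.accept)
    (hr : c.state ≠ primeAutomaton.reject) :
    ∃ t' < t, PrimeInvariant w.length t' (primeAutomaton.next w c) := by
  cases h with
  | start =>
    refine (PrimeInvariant.back (n := w.length) 1 0 0 (by omega) (by omega) (by omega) (by omega)
      (by omega)).exists_lt ?_ ?_
    · simp only [CounterAutomaton.next, primeAutomaton, HeadMove.apply]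
      exact config_eq (by omega) (by simp) (by simp)
    · rw [Prod.Lex.toLex_lt_toLex]; omega
  | first x y m h hd hn hdvd =>
    rcases Nat.eq_zero_or_pos m with rfl | hm
    · have hs := tapeSymbolAt_of_length_lt (show w.length < y + 1 by omega)
      rcases Nat.eq_zero_or_pos x with rfl | hx
      -- The first block fills the whole input, so n is the current divisor and has no smaller
      -- divisor e ≥ 2.
      · refine (PrimeInvariant.accept (n := w.length) (y + 1) 0 y (by omega)
          (Nat.prime_def_lt'.2 ⟨by omega, fun e he hl => hdvd e he (by omega)⟩)).exists_lt ?_ ?_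
        · simp only [CounterAutomaton.next, primeAutomaton, HeadMove.apply, hs,
            Matrix.cons_val_zero, Nat.cast_zero, counterStatus_zero]
          exact config_eq (by omega) (by simp) (by simp)
        · rw [Prod.Lex.toLex_lt_toLex]; omega
      · have hx' : (x : ℤ) ≠ 0 := by omega
        -- The divisor exceeds n, which `hn` permits only for the divisor 2; hence n < 2.
        refine (PrimeInvariant.reject (n := w.length) (y + 1) x y (by omega)
          (fun hp => by have := hp.two_le; omega)).exists_lt ?_ ?_
        · simp only [CounterAutomaton.next, primeAutomaton, HeadMove.apply, hs,
            Matrix.cons_val_zero, counterStatus_of_ne hx']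
          exact config_eq (by omega) (by simp) (by simp)
        · rw [Prod.Lex.toLex_lt_toLex]; omega
    · have hs := tapeSymbolAt_unary (show 0 < y + 1 by omega) (show y + 1 ≤ w.length by omega)
      rcases Nat.eq_zero_or_pos x with rfl | hx
      · refine (PrimeInvariant.give (n := w.length) 0 y 1 m (by omega) (by omega) (by omega)
          (by omega) hdvd).exists_lt ?_ ?_
        · simp only [CounterAutomaton.next, primeAutomaton, HeadMove.apply, hs,
            Matrix.cons_val_zero, Nat.cast_zero, counterStatus_zero]
          exact config_eq (by omega) (by simp) (by simp)
        · rw [Prod.Lex.toLex_lt_toLex]; split_ifs <;> omega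
      · have hx' : (x : ℤ) ≠ 0 := by omega
        obtain ⟨x, rfl⟩ : ∃ x', x = x' + 1 := ⟨x - 1, by omega⟩
        refine (PrimeInvariant.first (n := w.length) x (y + 1) (m - 1) (by omega) (by omega)
          (by omega) (fun e he hl => hdvd e he (by omega))).exists_lt ?_ ?_
        · simp only [CounterAutomaton.next, primeAutomaton, HeadMove.apply, hs,
            Matrix.cons_val_zero, counterStatus_of_ne hx']
          exact config_eq (by omega) (by simp) (by simp)
        · rw [Prod.Lex.toLex_lt_toLex]; split_ifs <;> omega
  | give x y q m h hd hq hn hdvd =>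
    have hle : x + y ≤ (x + y) * q := Nat.le_mul_of_pos_right _ hq
    rcases Nat.eq_zero_or_pos m with rfl | hm
    · have hs := tapeSymbolAt_of_length_lt (show w.length < (x + y) * q + x + 1 by omega)
      rcases Nat.eq_zero_or_pos y with rfl | hy
      · refine (PrimeInvariant.reject (n := w.length) ((x + 0) * q + x + 1) x 0 (by omega)
          (not_prime_of_eq_mul h hd hq)).exists_lt ?_ ?_
        · simp only [CounterAutomaton.next, primeAutomaton, HeadMove.apply, hs,
            Matrix.cons_val_zero, Matrix.cons_val_one, Nat.cast_zero, counterStatus_zero]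
          exact config_eq (by omega) (by simp) (by simp)
        · rw [Prod.Lex.toLex_lt_toLex]; omega
      · have hy' : (y : ℤ) ≠ 0 := by omega
        have hdvd' : ∀ e, 2 ≤ e → e ≤ x + y → ¬ e ∣ w.length := by
          intro e he hl
          rcases Nat.lt_or_ge e (x + y) with hlt | hge
          · exact hdvd e he hlt
          · exact (show e = x + y by omega) ▸
              not_dvd_of_eq_mul_add (show (x + y) * q + x = w.length from h) (by omega) (by omega)
        refine (PrimeInvariant.back (n := w.length) x y ((x + y) * q + x + 1) (by omega)
          (by omega) (by omega) (by omega) hdvd').exists_lt ?_ ?_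
        · simp only [CounterAutomaton.next, primeAutomaton, HeadMove.apply, hs,
            Matrix.cons_val_zero, Matrix.cons_val_one, counterStatus_of_ne hy']
          exact config_eq (by omega) (by simp) (by simp)
        · rw [Prod.Lex.toLex_lt_toLex]; split_ifs <;> omega
    · have hs := tapeSymbolAt_unary (show 0 < (x + y) * q + x + 1 by omega)
        (show (x + y) * q + x + 1 ≤ w.length by omega)
      rcases Nat.eq_zero_or_pos y with rfl | hy
      · have e : (x + 0) * (q + 1) = (x + 0) * q + x := by ring
        refine (PrimeInvariant.take (n := w.length) x 0 (q + 1) m (by omega) (by omega)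
          (by omega) (by omega) hdvd).exists_lt ?_ ?_
        · simp only [CounterAutomaton.next, primeAutomaton, HeadMove.apply, hs,
            Matrix.cons_val_zero, Matrix.cons_val_one, Nat.cast_zero, counterStatus_zero]
          exact config_eq (by omega) (by simp) (by simp)
        · rw [Prod.Lex.toLex_lt_toLex]; split_ifs <;> omega
      · have hy' : (y : ℤ) ≠ 0 := by omega
        obtain ⟨y, rfl⟩ : ∃ y', y = y' + 1 := ⟨y - 1, by omega⟩
        have e : x + 1 + y = x + (y + 1) := by omega
        refine (PrimeInvariant.give (n := w.length) (x + 1) y q (m - 1) (by rw [e]; omega)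
          (by omega) hq (by rwa [e]) (by rwa [e])).exists_lt ?_ ?_
        · simp only [CounterAutomaton.next, primeAutomaton, HeadMove.apply, hs, e,
            Matrix.cons_val_zero, Matrix.cons_val_one, counterStatus_of_ne hy']
          exact config_eq (by omega) (by simp) (by simp)
        · rw [Prod.Lex.toLex_lt_toLex]; split_ifs <;> omega
  | take x y q m h hd hq hn hdvd =>
    have hle : x + y ≤ (x + y) * q := Nat.le_mul_of_pos_right _ hq
    rcases Nat.eq_zero_or_pos m with rfl | hm
    · have hs := tapeSymbolAt_of_length_lt (show w.length < (x + y) * q + y + 1 by omega)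
      rcases Nat.eq_zero_or_pos x with rfl | hx
      · refine (PrimeInvariant.reject (n := w.length) ((0 + y) * q + y + 1) 0 y (by omega)
          (not_prime_of_eq_mul (d := 0 + y) (by omega) hd hq)).exists_lt ?_ ?_
        · simp only [CounterAutomaton.next, primeAutomaton, HeadMove.apply, hs,
            Matrix.cons_val_zero, Matrix.cons_val_one, Nat.cast_zero, counterStatus_zero]
          exact config_eq (by omega) (by simp) (by simp)
        · rw [Prod.Lex.toLex_lt_toLex]; omega
      · have hx' : (x : ℤ) ≠ 0 := by omega
        have hdvd' : ∀ e, 2 ≤ e → e ≤ x + y → ¬ e ∣ w.length := by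
          intro e he hl
          rcases Nat.lt_or_ge e (x + y) with hlt | hge
          · exact hdvd e he hlt
          · exact (show e = x + y by omega) ▸
              not_dvd_of_eq_mul_add (show (x + y) * q + y = w.length from h) (by omega) (by omega)
        refine (PrimeInvariant.back (n := w.length) x y ((x + y) * q + y + 1) (by omega)
          (by omega) (by omega) (by omega) hdvd').exists_lt ?_ ?_
        · simp only [CounterAutomaton.next, primeAutomaton, HeadMove.apply, hs,
            Matrix.cons_val_zero, Matrix.cons_val_one, counterStatus_of_ne hx']
          exact config_eq (by omega) (by simp) (by simp)
        · rw [Prod.Lex.toLex_lt_toLex]; split_ifs <;> omega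
    · have hs := tapeSymbolAt_unary (show 0 < (x + y) * q + y + 1 by omega)
        (show (x + y) * q + y + 1 ≤ w.length by omega)
      rcases Nat.eq_zero_or_pos x with rfl | hx
      · have e : (0 + y) * (q + 1) = (0 + y) * q + y := by ring
        refine (PrimeInvariant.give (n := w.length) 0 y (q + 1) m (by omega) (by omega)
          (by omega) (by omega) hdvd).exists_lt ?_ ?_
        · simp only [CounterAutomaton.next, primeAutomaton, HeadMove.apply, hs,
            Matrix.cons_val_zero, Matrix.cons_val_one, Nat.cast_zero, counterStatus_zero]
          exact config_eq (by omega) (by simp) (by simp)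
        · rw [Prod.Lex.toLex_lt_toLex]; split_ifs <;> omega
      · have hx' : (x : ℤ) ≠ 0 := by omega
        obtain ⟨x, rfl⟩ : ∃ x', x = x' + 1 := ⟨x - 1, by omega⟩
        have e : x + (y + 1) = x + 1 + y := by omega
        refine (PrimeInvariant.take (n := w.length) x (y + 1) q (m - 1) (by rw [e]; omega)
          (by omega) hq (by rwa [e]) (by rwa [e])).exists_lt ?_ ?_
        · simp only [CounterAutomaton.next, primeAutomaton, HeadMove.apply, hs, e,
            Matrix.cons_val_zero, Matrix.cons_val_one, counterStatus_of_ne hx']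
          exact config_eq (by omega) (by simp) (by simp)
        · rw [Prod.Lex.toLex_lt_toLex]; split_ifs <;> omega
  | back x y p hy hp hd hn hdvd =>
    rcases Nat.eq_zero_or_pos p with rfl | hp₀
    · obtain rfl : y = 0 := by omega
      refine (PrimeInvariant.first (n := w.length) (x + 1) 0 w.length (by omega) (by omega)
        (by omega) (fun e he hl => hdvd e he (by omega))).exists_lt ?_ ?_
      · simp only [CounterAutomaton.next, primeAutomaton, HeadMove.apply, tapeSymbolAt_zero]
        exact config_eq (by omega) (by simp) (by simp)
      · rw [Prod.Lex.toLex_lt_toLex]; omega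
    · have hs : tapeSymbolAt w p = .letter () ∨ tapeSymbolAt w p = .rightEnd := by
        rcases Nat.lt_or_ge w.length p with hlt | hge
        · exact .inr (tapeSymbolAt_of_length_lt hlt)
        · exact .inl (tapeSymbolAt_unary hp₀ hge)
      rcases Nat.eq_zero_or_pos y with rfl | hy₀
      · refine (PrimeInvariant.back (n := w.length) x 0 (p - 1) (by omega) (by omega) hd hn hdvd).exists_lt ?_ ?_
        · rcases hs with hs | hs <;>
          · simp only [CounterAutomaton.next, primeAutomaton, HeadMove.apply, hs,
              Matrix.cons_val_zero, Matrix.cons_val_one, Nat.cast_zero, counterStatus_zero]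
            exact config_eq (by omega) (by simp) (by simp)
        · rw [Prod.Lex.toLex_lt_toLex]; omega
      · have hy' : (y : ℤ) ≠ 0 := by omega
        obtain ⟨y, rfl⟩ : ∃ y', y = y' + 1 := ⟨y - 1, by omega⟩
        have e : x + 1 + y = x + (y + 1) := by omega
        refine (PrimeInvariant.back (n := w.length) (x + 1) y (p - 1) (by omega) (by omega)
          (by omega) (by omega) (by rwa [e])).exists_lt ?_ ?_
        · rcases hs with hs | hs <;>
          · simp only [CounterAutomaton.next, primeAutomaton, HeadMove.apply, hs,
              Matrix.cons_val_zero, Matrix.cons_val_one, counterStatus_of_ne hy']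
            exact config_eq (by omega) (by simp) (by simp)
        · rw [Prod.Lex.toLex_lt_toLex]; omega
  | accept => exact absurd rfl ha
  | reject => exact absurd rfl hr

theorem PrimeInvariant.initial (n : ℕ) :
    PrimeInvariant n (toLex (n + 4, 0)) primeAutomaton.initial := .start

theorem PrimeInvariant.abs_counter_le {n : ℕ} {t : ℕ ×ₗ ℕ} {c : primeAutomaton.Config}
    (h : PrimeInvariant n t c) (j : Fin 2) : |c.counter j| ≤ n + 2 := by
  cases h with
  | start => simp; omega
  | first x y m h hd hn => fin_cases j <;> simp <;> omega
  | give x y q m h hd hq hn =>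
    have hle : x + y ≤ (x + y) * q := Nat.le_mul_of_pos_right _ hq
    fin_cases j <;> simp <;> omega
  | take x y q m h hd hq hn =>
    have hle : x + y ≤ (x + y) * q := Nat.le_mul_of_pos_right _ hq
    fin_cases j <;> simp <;> omega
  | back x y p hy hp hd hn => fin_cases j <;> simp <;> omega
  | accept p x y hx => fin_cases j <;> simp <;> omega
  | reject p x y hx => fin_cases j <;> simp <;> omega

theorem recognizedByLinearlyBounded2D2CA_primes :
    RecognizedByLinearlyBounded2D2CA
      ({w | ∃ p : ℕ, p.Prime ∧ w = unaryWord p} : Language Unit) := by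
  refine ⟨primeAutomaton, ⟨2, fun w c hc j => ?_⟩, fun w => ?_⟩
  · obtain ⟨t, ht⟩ := CounterAutomaton.reaches_of_invariant (PrimeInvariant.initial w.length)
      (fun _ _ h => h.step) hc
    have := ht.abs_counter_le j
    push_cast
    omega
  · refine Iff.trans ?_ (CounterAutomaton.accepts_iff_of_invariant
      (P := w.length.Prime) (PrimeInvariant.initial w.length)
      (fun _ _ h => h.step) ?_ ?_).symm
    · simp only [eq_unaryWord_iff]
      exact ⟨fun ⟨p, hp, h⟩ => h ▸ hp, fun h => ⟨_, h, rfl⟩⟩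
    · rintro t c h ha
      cases h with
      | accept p x y hx h => exact h
      | _ => cases ha
    · rintro t c h hr
      cases h with
      | reject p x y hx h => exact h
      | _ => cases hr

/-! ### Scaling machines and their simulation with one counter -/

/-- What a scaling machine does next: it multiplies its register by the fraction `num / den`,
restarts with the input length in its register, or halts. -/
inductive ScalingOutcome (Q : Type) where
  | scale (q : Q) (num den : ℕ)
  | restart (q : Q)
  | accept
  | reject

/-- A machine with one register, which stores a natural number `v`. In one step it reads its state,
the residue of `v` modulo `modulus`, and whether `v < modulus`. -/
structure ScalingMachine where
  State : Type
  finite_state : Finite State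
  start : State
  modulus : ℕ
  modulus_pos : 0 < modulus
  bound : ℕ
  bound_pos : 0 < bound
  rule : State → ℕ → Bool → ScalingOutcome State
  den_dvd : ∀ {q r b q' num den}, rule q r b = .scale q' num den → den ∣ modulus
  num_le : ∀ {q r b q' num den}, rule q r b = .scale q' num den → num ≤ bound

/-- The element of `Fin (m + 1)` that is nearest to `x`. -/
def finClamp (m x : ℕ) : Fin (m + 1) := ⟨min x m, by omega⟩

theorem finClamp_val {m x : ℕ} (h : x ≤ m) : (finClamp m x : ℕ) = x := min_eq_left h

/-- Whether a tape symbol is the left end-marker. -/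
def TapeSymbol.isLeftEnd {α : Type} : TapeSymbol α → Bool
  | .leftEnd => true
  | _ => false

namespace ScalingMachine

/-- The states of the one-counter automaton that simulates a scaling machine. -/
inductive SimState (Q : Type) (m l : ℕ) where
  | seek (q : Q)
  | gather (q : Q) (r : Fin (m + 1))
  | spread (q : Q) (a t : Fin (l + 1))
  | accept
  | reject

instance (Q : Type) [Finite Q] (m l : ℕ) : Finite (SimState Q m l) := by
  let f : SimState Q m l → Q ⊕ (Q × Fin (m + 1)) ⊕ (Q × Fin (l + 1) × Fin (l + 1)) ⊕ Bool
    | .seek q => .inl q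
    | .gather q r => .inr (.inl (q, r))
    | .spread q a t => .inr (.inr (.inl (q, a, t)))
    | .accept => .inr (.inr (.inr true))
    | .reject => .inr (.inr (.inr false))
  refine Finite.of_injective f ?_
  rintro (_ | _ | _ | _ | _) (_ | _ | _ | _ | _) h <;> simp_all [f]

variable (S : ScalingMachine)

/-- The largest number that the simulating automaton adds to its counter for one square. -/
def maxAdd : ℕ := S.modulus * S.bound

/-- The states of the automaton that simulates `S`. -/
abbrev AutState : Type := SimState S.State S.modulus S.maxAdd

/-- Clamping lets states be written with natural numbers, here and in `spreadState`; it is inactive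
within the bounds assumed in the lemmas on runs. -/
def gatherState (q : S.State) (r : ℕ) : S.AutState := .gather q (finClamp _ r)

def spreadState (q : S.State) (a t : ℕ) : S.AutState := .spread q (finClamp _ a) (finClamp _ t)

/-- The state in which the automaton starts to carry out a rule for the residue `r`. -/
def outcomeState (r : ℕ) : ScalingOutcome S.State → S.AutState
  | .scale q num den => S.spreadState q (S.modulus / den * num) (r / den * num)
  | .restart q => .seek q
  | .accept => .accept
  | .reject => .reject

/-- The transitions of the automaton that simulates `S`. The automaton divides its counter by the
modulus, the quotient being the head position and the remainder being part of the state; then it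
multiplies the quotient while the head returns to the left end-marker. -/
def simTrans (s : S.AutState) (a : TapeSymbol Unit) (θ : CounterStatus) :
    S.AutState × HeadMove × SignType :=
  match s with
  | .seek q =>
    match a with
    | .rightEnd => (S.spreadState q 1 0, .left, 0)
    | _ => (.seek q, .right, 0)
  | .gather q r =>
    match θ with
    | .zero => (S.outcomeState r (S.rule q r a.isLeftEnd), .stay, 0)
    | .nonzero =>
      if (r : ℕ) + 1 < S.modulus then (S.gatherState q (r + 1), .stay, -1)
      else match a with
      -- A default that keeps the head on the tape; it is not used while the register is below
      -- `S.modulus * (w.length + 2)`.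
      | .rightEnd => (.reject, .stay, 0)
      | _ => (S.gatherState q 0, .right, -1)
  | .spread q b t =>
    if (t : ℕ) = 0 then
      match a with
      | .leftEnd => (S.gatherState q 0, .stay, 0)
      | _ => (S.spreadState q b b, .left, 0)
    else (S.spreadState q b (t - 1), .stay, 1)
  | .accept => (.accept, .stay, 0)
  | .reject => (.reject, .stay, 0)

/-- The one-counter automaton that simulates `S`. -/
def automaton : CounterAutomaton 1 Unit where
  State := S.AutState
  finite_state := have := S.finite_state; inferInstance
  start := .seek S.start
  accept := .accept
  reject := .reject
  accept_ne_reject := by simp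
  trans s a θ := ((S.simTrans s a (θ 0)).1, (S.simTrans s a (θ 0)).2.1,
    fun _ => (S.simTrans s a (θ 0)).2.2)
  trans_leftEnd s θ := by
    cases s <;> cases θ 0 <;> simp only [simTrans] <;> (try split_ifs) <;> simp
  trans_rightEnd s θ := by
    cases s <;> cases θ 0 <;> simp only [simTrans] <;> (try split_ifs) <;> simp

/-- A configuration of the simulating automaton. -/
def conf (s : S.AutState) (p v : ℕ) : S.automaton.Config := ⟨s, p, fun _ => (v : ℤ)⟩

variable {S} {w : List Unit}

theorem step_conf {s s' : S.AutState} {p p' v v' : ℕ} {a : TapeSymbol Unit} {m : HeadMove}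
    {δ : SignType} (ha : s ≠ .accept) (hr : s ≠ .reject) (hs : tapeSymbolAt w p = a)
    (ht : S.simTrans s a (counterStatus v) = (s', m, δ)) (hp : m.apply p = p')
    (hv : (v : ℤ) + (δ : ℤ) = v') :
    S.automaton.Step w (S.conf s p v) (S.conf s' p' v') := by
  refine ⟨ha, hr, ?_⟩
  simp [conf, CounterAutomaton.next, automaton, hs, ht, hp, hv]

theorem counterStatus_natCast_succ (v : ℕ) :
    counterStatus ((v : ℤ) + 1) = CounterStatus.nonzero :=
  counterStatus_of_ne (by omega)

/-- The total `S.modulus * p + r + v` is invariant: units pass from the counter to the remainder,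
and a full remainder becomes one head move. Its bound keeps the head at or before the right
end-marker. -/
theorem gather_reaches (q : S.State) (v : ℕ) : ∀ {p r : ℕ}, r < S.modulus →
    S.modulus * p + r + v < S.modulus * (w.length + 2) →
    Relation.ReflTransGen (S.automaton.Step w) (S.conf (S.gatherState q r) p v)
      (S.conf (S.gatherState q ((S.modulus * p + r + v) % S.modulus))
        ((S.modulus * p + r + v) / S.modulus) 0) := by
  induction v with
  | zero =>
    intro p r hr h
    have h₁ : (S.modulus * p + r + 0) % S.modulus = r := by
      rw [add_zero, Nat.mul_add_mod, Nat.mod_eq_of_lt hr]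
    have h₂ : (S.modulus * p + r + 0) / S.modulus = p := by
      rw [add_zero, Nat.mul_add_div S.modulus_pos, Nat.div_eq_of_lt hr, add_zero]
    rw [h₁, h₂]
  | succ v ih =>
    intro p r hr h
    by_cases hr' : r + 1 < S.modulus
    · refine .head ?_ (show S.modulus * p + r + (v + 1) = S.modulus * p + (r + 1) + v by ring ▸
        ih (p := p) (r := r + 1) hr' (by omega))
      refine step_conf (by simp [gatherState]) (by simp [gatherState]) rfl
        (m := .stay) (δ := -1) ?_ rfl (by push_cast; simp)
      simp [simTrans, gatherState, counterStatus_natCast_succ, finClamp_val hr.le, hr']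
    · have hm : r + 1 = S.modulus := by omega
      have e : S.modulus * p + r + (v + 1) = S.modulus * (p + 1) + 0 + v := by
        rw [mul_add]; omega
      rw [e] at h ⊢
      refine .head ?_ (ih (p := p + 1) (r := 0) S.modulus_pos h)
      have hp : p + 1 < w.length + 2 := lt_of_mul_lt_mul_left (a := S.modulus) (by omega) (by omega)
      have hs : tapeSymbolAt w p = .leftEnd ∨ tapeSymbolAt w p = .letter () := by
        rcases Nat.eq_zero_or_pos p with rfl | hp₀
        · exact .inl rfl
        · exact .inr (tapeSymbolAt_unary hp₀ (by omega))
      refine step_conf (by simp [gatherState]) (by simp [gatherState]) rfl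
        (m := .right) (δ := -1) ?_ rfl (by push_cast; simp)
      rcases hs with hs | hs <;>
        simp [simTrans, gatherState, counterStatus_natCast_succ, finClamp_val hr.le, hr', hs]

theorem spread_reaches_of_add (q : S.State) {a : ℕ} (p : ℕ) (ha : a ≤ S.maxAdd) (t : ℕ)
    (v : ℕ) (ht : t ≤ S.maxAdd) :
    Relation.ReflTransGen (S.automaton.Step w) (S.conf (S.spreadState q a t) p v)
      (S.conf (S.spreadState q a 0) p (v + t)) := by
  induction t generalizing v with
  | zero => exact .refl
  | succ t ih =>
    refine .head ?_ (show v + (t + 1) = v + 1 + t by ring ▸ ih (v + 1) (by omega))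
    refine step_conf (by simp [spreadState]) (by simp [spreadState]) rfl
      (m := .stay) (δ := 1) ?_ rfl (by push_cast; simp)
    simp [simTrans, spreadState, finClamp_val ha, finClamp_val ht]

/-- The pending amount t is added on the present square, and each of the p moves to the left makes a
further amount a pending. -/
theorem spread_reaches (q : S.State) {a : ℕ} (ha : a ≤ S.maxAdd) (p t v : ℕ)
    (ht : t ≤ S.maxAdd) :
    Relation.TransGen (S.automaton.Step w) (S.conf (S.spreadState q a t) p v)
      (S.conf (S.gatherState q 0) 0 (v + t + a * p)) := by
  induction p generalizing t v with
  | zero =>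
    refine .tail' (spread_reaches_of_add q 0 ha t v ht) ?_
    refine step_conf (by simp [spreadState]) (by simp [spreadState]) rfl
      (m := .stay) (δ := 0) ?_ rfl (by simp)
    simp [simTrans, spreadState, finClamp_val (Nat.zero_le _), tapeSymbolAt_zero]
  | succ p ih =>
    refine .trans_right (spread_reaches_of_add q (p + 1) ha t v ht) ?_
    refine .head ?_ (show v + t + a * (p + 1) = v + t + a + a * p by ring ▸ ih a (v + t) ha)
    have hs : tapeSymbolAt w (p + 1) = .letter () ∨ tapeSymbolAt w (p + 1) = .rightEnd := by
      rcases Nat.lt_or_ge w.length (p + 1) with hlt | hge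
      · exact .inr (tapeSymbolAt_of_length_lt hlt)
      · exact .inl (tapeSymbolAt_unary (by omega) hge)
    refine step_conf (by simp [spreadState]) (by simp [spreadState]) rfl
      (m := .left) (δ := 0) ?_ rfl (by simp)
    rcases hs with hs | hs <;>
      simp [simTrans, spreadState, finClamp_val (Nat.zero_le _), finClamp_val ha, hs]

theorem seek_reaches (q : S.State) {p : ℕ} (hp : p ≤ w.length + 1) :
    Relation.TransGen (S.automaton.Step w) (S.conf (.seek q) p 0)
      (S.conf (S.gatherState q 0) 0 w.length) := by
  induction hp using Nat.decreasingInduction with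
  | of_succ p hp ih =>
    refine .head ?_ ih
    have hs : tapeSymbolAt w p = .leftEnd ∨ tapeSymbolAt w p = .letter () := by
      rcases Nat.eq_zero_or_pos p with rfl | hp₀
      · exact .inl rfl
      · exact .inr (tapeSymbolAt_unary hp₀ (by omega))
    refine step_conf (by simp) (by simp) rfl (m := .right) (δ := 0) ?_ rfl (by simp)
    rcases hs with hs | hs <;> simp [simTrans, hs]
  | self =>
    -- Starting on the last square before the right end-marker with nothing pending, each of the
    -- `w.length` moves to the left adds one.
    have h := spread_reaches (w := w) q (a := 1) (Nat.mul_pos S.modulus_pos S.bound_pos)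
      w.length 0 0 (Nat.zero_le _)
    simp only [zero_add, one_mul] at h
    refine .head ?_ h
    refine step_conf (by simp) (by simp) (tapeSymbolAt_of_length_lt (Nat.lt_succ_self _))
      (m := .left) (δ := 0) ?_ rfl (by simp)
    simp [simTrans]

/-- The configuration of the simulating automaton that represents the state `q` and the register
content `v`. -/
def reg (q : S.State) (v : ℕ) : S.automaton.Config := S.conf (S.gatherState q 0) 0 v

/-- Gathering ends on the left end-marker exactly when the quotient is zero, so the scanned symbol
decides v < modulus. -/
theorem reg_reaches_outcome (q : S.State) {v : ℕ} (hv : v < S.modulus * (w.length + 2)) :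
    Relation.TransGen (S.automaton.Step w) (reg q v)
      (S.conf (S.outcomeState (v % S.modulus)
        (S.rule q (v % S.modulus) (decide (v < S.modulus)))) (v / S.modulus) 0) := by
  have h := gather_reaches (w := w) q v (p := 0) (r := 0) S.modulus_pos (by simpa using hv)
  simp only [mul_zero, zero_add] at h
  refine .tail' h ?_
  have hr := Nat.mod_lt v S.modulus_pos
  have hs : (tapeSymbolAt w (v / S.modulus)).isLeftEnd = decide (v < S.modulus) := by
    rcases Nat.lt_or_ge v S.modulus with hlt | hge
    · rw [Nat.div_eq_of_lt hlt]
      simp [tapeSymbolAt_zero, TapeSymbol.isLeftEnd, hlt]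
    · have hpos : 0 < v / S.modulus := Nat.div_pos hge S.modulus_pos
      rcases Nat.lt_or_ge w.length (v / S.modulus) with h' | h'
      · simp [tapeSymbolAt_of_length_lt h', TapeSymbol.isLeftEnd, hge]
      · simp [tapeSymbolAt_unary hpos h', TapeSymbol.isLeftEnd, hge]
  refine step_conf (by simp [gatherState]) (by simp [gatherState]) rfl
    (m := .stay) (δ := 0) ?_ rfl (by simp)
  simp [simTrans, gatherState, counterStatus_zero, finClamp_val hr.le, hs]

theorem div_eq_div_mul_add (m v : ℕ) {d : ℕ} (hd : d ∣ m) (hm : 0 < m) :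
    v / d = m / d * (v / m) + v % m / d := by
  obtain ⟨e, rfl⟩ := hd
  have hd : 0 < d := Nat.pos_of_mul_pos_right hm
  conv_lhs => rw [← Nat.div_add_mod v (d * e)]
  rw [mul_assoc, Nat.mul_add_div hd, Nat.mul_div_cancel_left _ hd]

/-- Because den divides the modulus, each unit of the quotient contributes modulus / den * num, and
the remainder contributes its own share once (`div_eq_div_mul_add`). Only the old register content
has to be bounded. -/
theorem reg_scale {q q' : S.State} {v num den : ℕ} (hv : v < S.modulus * (w.length + 2))
    (h : S.rule q (v % S.modulus) (decide (v < S.modulus)) = .scale q' num den) :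
    Relation.TransGen (S.automaton.Step w) (reg q v) (reg q' (v / den * num)) := by
  have h₁ := reg_reaches_outcome q hv
  rw [h] at h₁
  have hn := S.num_le h
  have hle : ∀ x ≤ S.modulus, x / den * num ≤ S.maxAdd := fun x hx =>
    Nat.mul_le_mul ((Nat.div_le_self _ _).trans hx) hn
  have h₂ := spread_reaches (w := w) q' (hle _ le_rfl) (v / S.modulus) _ 0
    (hle _ (Nat.mod_lt v S.modulus_pos).le)
  have e : 0 + v % S.modulus / den * num + S.modulus / den * num * (v / S.modulus) =
      v / den * num := by
    rw [div_eq_div_mul_add S.modulus v (S.den_dvd h) S.modulus_pos]; ring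
  exact h₁.trans (e ▸ h₂)

theorem reg_restart {q q' : S.State} {v : ℕ} (hv : v < S.modulus * (w.length + 2))
    (h : S.rule q (v % S.modulus) (decide (v < S.modulus)) = .restart q') :
    Relation.TransGen (S.automaton.Step w) (reg q v) (reg q' w.length) := by
  have h₁ := reg_reaches_outcome q hv
  rw [h] at h₁
  exact h₁.trans (seek_reaches q' (Nat.lt_succ_iff.1 (Nat.div_lt_of_lt_mul hv)))

theorem acceptsFrom_reg_of_accept {q : S.State} {v : ℕ} (hv : v < S.modulus * (w.length + 2))
    (h : S.rule q (v % S.modulus) (decide (v < S.modulus)) = .accept) :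
    S.automaton.AcceptsFrom w (reg q v) := by
  have h₁ := reg_reaches_outcome q hv
  rw [h] at h₁
  exact ⟨_, h₁.to_reflTransGen, rfl⟩

theorem not_acceptsFrom_reg_of_reject {q : S.State} {v : ℕ}
    (hv : v < S.modulus * (w.length + 2))
    (h : S.rule q (v % S.modulus) (decide (v < S.modulus)) = .reject) :
    ¬ S.automaton.AcceptsFrom w (reg q v) := by
  have h₁ := reg_reaches_outcome q hv
  rw [h] at h₁
  rw [CounterAutomaton.acceptsFrom_iff_of_reaches h₁.to_reflTransGen]
  exact CounterAutomaton.not_acceptsFrom_of_reject rfl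

theorem accepts_iff : S.automaton.Accepts w ↔ S.automaton.AcceptsFrom w (reg S.start w.length) :=
  CounterAutomaton.acceptsFrom_iff_of_reaches
    (seek_reaches S.start (p := 0) (Nat.zero_le _)).to_reflTransGen

end ScalingMachine

/-! ### Signed counters with the last digit in the state -/

/-- A sign and a last digit in base `m + 1`; `true` is the negative sign. -/
abbrev SignedDigit (m : ℕ) : Type := Bool × Fin (m + 1)

/-- The integer with the given sign and last digit whose other digits form the number `h`. -/
def SignedDigit.decode {m : ℕ} (d : SignedDigit m) (h : ℕ) : ℤ :=
  (if d.1 then -1 else 1) * ((m + 1) * h + (d.2 : ℕ))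

/-- The effect of adding `δ` on the sign and the last digit, and the change of the number that is
formed by the other digits; `z` tells whether this number is zero. -/
def SignedDigit.add {m : ℕ} (d : SignedDigit m) (z : Bool) (δ : SignType) :
    SignedDigit m × SignType :=
  if δ = 0 then (d, 0)
  else if d.1 = decide (δ = -1) ∨ ((d.2 : ℕ) = 0 ∧ z) then
    if (d.2 : ℕ) < m then ((decide (δ = -1), finClamp m (d.2 + 1)), 0)
    else ((decide (δ = -1), finClamp m 0), 1)
  else if (d.2 : ℕ) = 0 then ((d.1, finClamp m m), -1)
  else ((d.1, finClamp m (d.2 - 1)), 0)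

theorem SignedDigit.decode_eq_zero {m : ℕ} (d : SignedDigit m) (h : ℕ) :
    d.decode h = 0 ↔ (d.2 : ℕ) = 0 ∧ h = 0 := by
  have h₁ : ((m : ℤ) + 1) * h + ((d.2 : ℕ) : ℤ) = 0 ↔ (d.2 : ℕ) = 0 ∧ h = 0 := by
    have : ((m : ℤ) + 1) * h + ((d.2 : ℕ) : ℤ) = (((m + 1) * h + (d.2 : ℕ) : ℕ) : ℤ) := by
      push_cast; ring
    rw [this, Nat.cast_eq_zero, Nat.add_eq_zero_iff, Nat.mul_eq_zero]
    omega
  rw [SignedDigit.decode, mul_eq_zero, h₁]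
  have h₂ : (if d.1 then -1 else 1 : ℤ) ≠ 0 := by split_ifs <;> simp
  simp [h₂]

theorem SignedDigit.abs_decode {m : ℕ} (d : SignedDigit m) (h : ℕ) :
    |d.decode h| = (m + 1) * h + (d.2 : ℕ) := by
  have h₁ : (0 : ℤ) ≤ (m + 1) * h + (d.2 : ℕ) := by positivity
  rw [SignedDigit.decode]
  split_ifs <;> simp [abs_of_nonneg h₁]
  rw [← abs_neg, abs_of_nonneg] <;> linarith

/-- If the sign agrees with δ or the value is zero, the magnitude grows, with a carry out of the
digit m; otherwise it shrinks, with a borrow at the digit 0. Zero may bear either sign. -/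
theorem SignedDigit.decode_add {m : ℕ} (d : SignedDigit m) (h : ℕ) (δ : SignType) :
    ∃ h' : ℕ, (h' : ℤ) = h + ((d.add (decide (h = 0)) δ).2 : ℤ) ∧
      (d.add (decide (h = 0)) δ).1.decode h' = d.decode h + δ := by
  obtain ⟨s, r⟩ := d
  have hr : (r : ℕ) ≤ m := by omega
  by_cases hδ : δ = 0
  · exact ⟨h, by simp [SignedDigit.add, hδ], by simp [SignedDigit.add, hδ]⟩
  have hsign : (δ : ℤ) = if δ = -1 then -1 else 1 := by cases δ <;> simp_all
  by_cases h₁ : s = decide (δ = -1) ∨ ((r : ℕ) = 0 ∧ h = 0)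
  · have hd : SignedDigit.decode (s, r) h =
        (if δ = -1 then -1 else 1) * ((m + 1) * h + (r : ℕ)) := by
      rcases h₁ with rfl | ⟨h₂, h₃⟩
      · simp [SignedDigit.decode]
      · simp [SignedDigit.decode, h₂, h₃]
    by_cases h₂ : (r : ℕ) < m
    · have hadd : SignedDigit.add (s, r) (decide (h = 0)) δ =
          ((decide (δ = -1), finClamp m (r + 1)), 0) := by
        rw [SignedDigit.add, if_neg hδ, if_pos (by simpa using h₁), if_pos h₂]
      refine ⟨h, by simp [hadd], ?_⟩
      rw [hadd, hd, hsign]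
      simp only [SignedDigit.decode, decide_eq_true_eq,
        finClamp_val (show (r : ℕ) + 1 ≤ m by omega)]
      push_cast
      ring
    · have h₃ : ((r : ℕ) : ℤ) = m := by omega
      have hadd : SignedDigit.add (s, r) (decide (h = 0)) δ =
          ((decide (δ = -1), finClamp m 0), 1) := by
        rw [SignedDigit.add, if_neg hδ, if_pos (by simpa using h₁), if_neg h₂]
      refine ⟨h + 1, by simp [hadd], ?_⟩
      rw [hadd, hd, hsign]
      simp only [SignedDigit.decode, decide_eq_true_eq, finClamp_val (Nat.zero_le _), h₃]
      push_cast
      ring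
  · have hs : s ≠ decide (δ = -1) := fun h => h₁ (.inl h)
    have hsign' : (δ : ℤ) = -(if s then -1 else 1) := by
      rw [hsign]
      by_cases h₂ : δ = -1 <;> cases s <;> simp_all
    by_cases h₂ : (r : ℕ) = 0
    · have hadd : SignedDigit.add (s, r) (decide (h = 0)) δ = ((s, finClamp m m), -1) := by
        rw [SignedDigit.add, if_neg hδ, if_neg (by simpa using h₁), if_pos h₂]
      -- The borrow is possible, since digit 0 with h = 0 belongs to the growing case.
      obtain ⟨h, rfl⟩ : ∃ h', h = h' + 1 :=
        ⟨h - 1, by have : h ≠ 0 := fun h => h₁ (.inr ⟨h₂, h⟩); omega⟩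
      refine ⟨h, by rw [hadd]; simp, ?_⟩
      rw [hadd, hsign']
      simp only [SignedDigit.decode, finClamp_val le_rfl, h₂]
      push_cast
      ring
    · obtain ⟨t, ht⟩ : ∃ t, (r : ℕ) = t + 1 := ⟨r - 1, by omega⟩
      have hadd : SignedDigit.add (s, r) (decide (h = 0)) δ = ((s, finClamp m t), 0) := by
        rw [SignedDigit.add, if_neg hδ, if_neg (by simpa using h₁), if_neg h₂]
        simp [ht]
      refine ⟨h, by simp [hadd], ?_⟩
      rw [hadd, hsign']
      simp only [SignedDigit.decode, finClamp_val (show t ≤ m by omega), ht]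
      push_cast
      ring

/-! ### Exponents as counters and as head position -/

/-- The factor by which `p ^ h` has to be multiplied when `δ` is added to `h`. -/
def upFactor (p : ℕ) (δ : SignType) : ℕ := if δ = 1 then p else 1

/-- The factor by which `p ^ h` has to be divided when `δ` is added to `h`. -/
def downFactor (p : ℕ) (δ : SignType) : ℕ := if δ = -1 then p else 1

theorem upFactor_le {p : ℕ} (hp : 0 < p) (δ : SignType) : upFactor p δ ≤ p := by
  unfold upFactor; split_ifs <;> omega

theorem downFactor_dvd (p : ℕ) (δ : SignType) : downFactor p δ ∣ p := by
  unfold downFactor; split_ifs <;> simp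

/-- The common cofactor k makes the division exact. -/
theorem exists_pow_eq_factor_mul (p : ℕ) {h h' : ℕ} {δ : SignType} (e : (h' : ℤ) = h + (δ : ℤ)) :
    ∃ k, p ^ h = downFactor p δ * k ∧ p ^ h' = upFactor p δ * k := by
  cases δ
  · obtain rfl : h' = h := by simpa using e
    exact ⟨p ^ h', by simp [downFactor], by simp [upFactor]⟩
  · obtain rfl : h = h' + 1 := by simp at e; omega
    exact ⟨p ^ h', by simp [downFactor, pow_succ'], by simp [upFactor]⟩
  · obtain rfl : h' = h + 1 := by simp at e; omega
    exact ⟨p ^ h, by simp [downFactor], by simp [upFactor, pow_succ']⟩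

/-- The effect of a head move: whether the head is on the right end-marker, and the numerator and
the denominator of the fraction by which `2 ^ i * 3 ^ j` has to be multiplied, where `i` is the head
position and `j` the distance to the last letter; `z` tells whether `j` is zero. -/
def headRule (e z : Bool) : HeadMove → Bool × ℕ × ℕ
  | .left => if e then (false, 1, 1) else (false, 3, 2)
  | .stay => (e, 1, 1)
  | .right => if z then (true, 1, 1) else (false, 2, 3)

theorem headRule_num_le (e z : Bool) (m : HeadMove) : (headRule e z m).2.1 ≤ 3 := by
  cases e <;> cases z <;> cases m <;> simp [headRule]

theorem headRule_den_dvd (e z : Bool) (m : HeadMove) : (headRule e z m).2.2 ∣ 6 := by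
  cases e <;> cases z <;> cases m <;> simp [headRule]

/-- The head position that is represented by the exponents `i` and `j`. -/
structure HeadCode (n : ℕ) (e : Bool) (i j p : ℕ) : Prop where
  sum_eq : i + j = n
  eq_zero : e = true → j = 0
  pos_eq : p = i + if e then 1 else 0

/-- A move to the right trades a factor 3 for a factor 2, a move to the left the reverse. Between
square n and the right end-marker only the flag e changes. -/
theorem HeadCode.move {n : ℕ} {e : Bool} {i j p : ℕ} (h : HeadCode n e i j p) {m : HeadMove}
    (hl : p = 0 → m ≠ .left) (hr : e = true → m ≠ .right) :
    ∃ i' j' k, HeadCode n (headRule e (decide (j = 0)) m).1 i' j' (m.apply p) ∧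
      2 ^ i * 3 ^ j = (headRule e (decide (j = 0)) m).2.2 * k ∧
      2 ^ i' * 3 ^ j' = (headRule e (decide (j = 0)) m).2.1 * k := by
  obtain ⟨h₁, h₂, h₃⟩ := h
  cases m
  case left =>
    cases e
    · obtain ⟨i, rfl⟩ : ∃ i', i = i' + 1 :=
        ⟨i - 1, by have : i ≠ 0 := fun h => hl (by simpa [h] using h₃) rfl; omega⟩
      refine ⟨i, j + 1, 2 ^ i * 3 ^ j, ⟨by omega, by simp [headRule], ?_⟩, ?_, ?_⟩
      · simp [headRule, HeadMove.apply, h₃]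
      · simp only [headRule, Bool.false_eq_true, if_false]; ring
      · simp only [headRule, Bool.false_eq_true, if_false]; ring
    · refine ⟨i, j, 2 ^ i * 3 ^ j, ⟨h₁, by simp [headRule], ?_⟩, ?_, ?_⟩ <;>
        simp [headRule, HeadMove.apply, h₃]
  case stay =>
    exact ⟨i, j, 2 ^ i * 3 ^ j, ⟨h₁, h₂, h₃⟩, by simp [headRule], by simp [headRule]⟩
  case right =>
    have he : e = false := by simpa using hr
    subst he
    by_cases hj : j = 0
    · refine ⟨i, j, 2 ^ i * 3 ^ j, ⟨h₁, fun _ => hj, ?_⟩, ?_, ?_⟩ <;>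
        simp [headRule, HeadMove.apply, h₃, hj]
    · obtain ⟨j, rfl⟩ : ∃ j', j = j' + 1 := ⟨j - 1, by omega⟩
      refine ⟨i + 1, j, 2 ^ i * 3 ^ j, ⟨by omega, by simp [headRule], ?_⟩, ?_, ?_⟩
      · simp [headRule, HeadMove.apply, h₃]
      · simp [headRule]; ring
      · simp [headRule]; ring

/-- The symbol that is scanned; `z` tells whether the head position is zero. -/
def scannedSymbol (e z : Bool) : TapeSymbol Unit :=
  if e then .rightEnd else if z then .leftEnd else .letter ()

theorem HeadCode.tapeSymbolAt_eq {n : ℕ} {e : Bool} {i j p : ℕ} (h : HeadCode n e i j p)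
    {w : List Unit} (hw : w.length = n) :
    tapeSymbolAt w p = scannedSymbol e (decide (i = 0)) := by
  obtain ⟨h₁, h₂, h₃⟩ := h
  cases e
  · obtain rfl : p = i := by simpa using h₃
    rcases Nat.eq_zero_or_pos p with rfl | hp
    · simp [scannedSymbol, tapeSymbolAt_zero]
    · rw [tapeSymbolAt_unary hp (by omega)]
      simp [scannedSymbol, hp.ne']
  · have := h₂ rfl
    rw [tapeSymbolAt_of_length_lt (by simp at h₃; omega)]
    rfl

/-! ### Simulation of a two-counter automaton by a scaling machine -/

namespace CounterAutomaton

/-- The states of the scaling machine that simulates a two-counter automaton with state set `Q`. -/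
inductive UnaryState (Q : Type) (m : ℕ) where
  | check
  | strip
  | run (s : Q) (e : Bool) (d₀ d₁ : SignedDigit m)

instance (Q : Type) [Finite Q] (m : ℕ) : Finite (UnaryState Q m) := by
  let f : UnaryState Q m → Bool ⊕ (Q × Bool × SignedDigit m × SignedDigit m)
    | .check => .inl true
    | .strip => .inl false
    | .run s e d₀ d₁ => .inr (s, e, d₀, d₁)
  refine Finite.of_injective f ?_
  rintro (_ | _ | _) (_ | _ | _) h <;> simp_all [f]

variable (M : CounterAutomaton 2 Unit) (m : ℕ)

/-- The status of a counter with the digit `d`; `z` tells whether its other digits are zero. -/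
def digitStatus {m : ℕ} (d : SignedDigit m) (z : Bool) : CounterStatus :=
  if (d.2 : ℕ) = 0 ∧ z then .zero else .nonzero

theorem counterStatus_decode {m : ℕ} (d : SignedDigit m) (h : ℕ) :
    counterStatus (d.decode h) = digitStatus d (decide (h = 0)) := by
  simp only [counterStatus, digitStatus, d.decode_eq_zero, decide_eq_true_eq]

/-- The rule that simulates one step of `M`. The arguments `z` tell which of the exponents of
`2`, `3`, `5`, `7` in the register are zero. -/
def runRule (s : M.State) (e : Bool) (d₀ d₁ : SignedDigit m) (z₂ z₃ z₅ z₇ : Bool) :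
    ScalingOutcome (UnaryState M.State m) :=
  let t := M.trans s (scannedSymbol e z₂) ![digitStatus d₀ z₅, digitStatus d₁ z₇]
  let h := headRule e z₃ t.2.1
  let a₀ := d₀.add z₅ (t.2.2 0)
  let a₁ := d₁.add z₇ (t.2.2 1)
  .scale (.run t.1 h.1 a₀.1 a₁.1) (h.2.1 * upFactor 5 a₀.2 * upFactor 7 a₁.2)
    (h.2.2 * downFactor 5 a₀.2 * downFactor 7 a₁.2)

open Classical in
/-- The rules of the scaling machine that simulates `M`. It checks that its input `42 ^ n` is a
power of `42`, computes `3 ^ n`, and then represents a configuration of `M` on the input of length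
`n` by `2 ^ i * 3 ^ (n - i) * 5 ^ x * 7 ^ y`, where `i` is the head position and `x`, `y` are the
leading digits of the counters. -/
noncomputable def unaryRule :
    UnaryState M.State m → ℕ → Bool → ScalingOutcome (UnaryState M.State m)
  | .check, r, b =>
    -- This is the register content 0, which division by 42 would leave unchanged for ever.
    if r = 0 ∧ b then .reject
    else if 42 ∣ r then .scale .check 1 42
    else if r = 1 ∧ b then .restart .strip
    else .reject
  | .strip, r, _ =>
    if 14 ∣ r then .scale .strip 1 14
    else .scale (.run M.start false (false, 0) (false, 0)) 1 1
  | .run s e d₀ d₁, r, _ =>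
    if s = M.accept then .accept
    else if s = M.reject then .reject
    else runRule M m s e d₀ d₁ (decide (¬ 2 ∣ r)) (decide (¬ 3 ∣ r)) (decide (¬ 5 ∣ r))
      (decide (¬ 7 ∣ r))

/-- The extreme case is a step of `M`, with 6 * 5 * 7 = 210 and 3 * 5 * 7 = 105. -/
theorem unaryRule_scale {q q' : UnaryState M.State m} {r num den : ℕ} {b : Bool}
    (h : unaryRule M m q r b = .scale q' num den) : den ∣ 210 ∧ num ≤ 105 := by
  rcases q with _ | _ | ⟨s, e, d₀, d₁⟩
  · simp only [unaryRule] at h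
    split_ifs at h
    cases h
    norm_num
  · simp only [unaryRule] at h
    split_ifs at h <;> cases h <;> norm_num
  · simp only [unaryRule, runRule] at h
    split_ifs at h
    cases h
    constructor
    · exact mul_dvd_mul (mul_dvd_mul (headRule_den_dvd _ _ _) (downFactor_dvd 5 _))
        (downFactor_dvd 7 _)
    · exact Nat.mul_le_mul (Nat.mul_le_mul (headRule_num_le _ _ _)
        (upFactor_le (by norm_num) _)) (upFactor_le (by norm_num) _)

/-- The scaling machine that simulates `M`. -/
noncomputable def unaryMachine : ScalingMachine where
  State := UnaryState M.State m
  finite_state := have := M.finite_state; inferInstance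
  start := .check
  modulus := 210
  modulus_pos := by norm_num
  bound := 105
  bound_pos := by norm_num
  rule := unaryRule M m
  den_dvd h := (unaryRule_scale M m h).1
  num_le h := (unaryRule_scale M m h).2

open ScalingMachine

variable {M m} {w : List Unit}

/-- The automaton that simulates `M` in the state `q` of its scaling machine, with `v` in the
register. -/
noncomputable abbrev unaryReg (q : UnaryState M.State m) (v : ℕ) :
    (unaryMachine M m).automaton.Config :=
  ScalingMachine.reg (S := unaryMachine M m) q v

/-- Since 42 divides 210, the residue decides divisibility by 42, and repeated division ends in 1
exactly for the powers of 42. The check consumes the register, so it is followed by a restart. -/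
theorem acceptsFrom_check (v : ℕ) (hv : v ≤ w.length) :
    (unaryMachine M m).automaton.AcceptsFrom w (unaryReg .check v) ↔
      (∃ n, v = 42 ^ n) ∧
        (unaryMachine M m).automaton.AcceptsFrom w (unaryReg .strip w.length) := by
  induction v using Nat.strong_induction_on with
  | _ v ih =>
  have hv' : v < (unaryMachine M m).modulus * (w.length + 2) := by
    change v < 210 * _; omega
  by_cases h₀ : v = 0
  · have h := not_acceptsFrom_reg_of_reject (S := unaryMachine M m) (w := w) (q := .check) hv'
      (by simp [unaryMachine, unaryRule, h₀])
    refine iff_of_false h ?_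
    rintro ⟨⟨n, hn⟩, -⟩
    have : 0 < 42 ^ n := by positivity
    omega
  have h₁ : ¬ (v % 210 = 0 ∧ decide (v < 210) = true) := by
    rw [decide_eq_true_eq]; omega
  by_cases h₂ : 42 ∣ v % 210
  · obtain ⟨u, rfl⟩ : 42 ∣ v := by omega
    have h := reg_scale (S := unaryMachine M m) (w := w) (q := .check) (q' := .check)
      (num := 1) (den := 42) hv' 
      (show unaryRule M m .check (42 * u % 210) (decide (42 * u < 210)) = .scale .check 1 42 by
        rw [unaryRule, if_neg h₁, if_pos h₂])
    rw [acceptsFrom_iff_of_reaches h.to_reflTransGen, Nat.mul_div_cancel_left _ (by norm_num),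
      mul_one, ih u (by omega) (by omega)]
    refine and_congr_left fun _ => ⟨fun ⟨n, hn⟩ => ⟨n + 1, by rw [hn]; ring⟩, fun ⟨n, hn⟩ => ?_⟩
    rcases n with _ | n
    · omega
    · exact ⟨n, by rw [pow_succ'] at hn; omega⟩
  · by_cases h₃ : v = 1
    · have h := reg_restart (S := unaryMachine M m) (w := w) (q := .check) (q' := .strip) hv'
        (show unaryRule M m .check (v % 210) (decide (v < 210)) = .restart .strip by
          rw [unaryRule, if_neg h₁, if_neg h₂, if_pos]
          subst h₃
          exact ⟨rfl, rfl⟩)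
      rw [acceptsFrom_iff_of_reaches h.to_reflTransGen]
      exact ⟨fun h => ⟨⟨0, h₃⟩, h⟩, fun h => h.2⟩
    · have h := not_acceptsFrom_reg_of_reject (S := unaryMachine M m) (w := w) (q := .check) hv'
        (show unaryRule M m .check (v % 210) (decide (v < 210)) = .reject by
          rw [unaryRule, if_neg h₁, if_neg h₂, if_neg]
          rw [decide_eq_true_eq]
          omega)
      refine iff_of_false h ?_
      rintro ⟨⟨n, rfl⟩, -⟩
      rcases n with _ | n
      · simp at h₃
      · rw [pow_succ'] at h₂
        omega

/-- This is applied to 42 ^ n = 14 ^ n * 3 ^ n, where it produces the initial code without any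
record of n. -/
theorem acceptsFrom_strip {u : ℕ} (hu : ¬ 14 ∣ u) (k : ℕ) (hv : 14 ^ k * u ≤ w.length) :
    (unaryMachine M m).automaton.AcceptsFrom w (unaryReg .strip (14 ^ k * u)) ↔
      (unaryMachine M m).automaton.AcceptsFrom w
        (unaryReg (.run M.start false (false, 0) (false, 0)) u) := by
  induction k with
  | zero =>
    rw [pow_zero, one_mul] at hv ⊢
    have h := reg_scale (S := unaryMachine M m) (w := w) (q := .strip) (v := u)
      (q' := .run M.start false (false, 0) (false, 0)) (num := 1) (den := 1)
      (by change u < 210 * _; omega) 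
      (show unaryRule M m .strip (u % 210) (decide (u < 210)) =
          .scale (.run M.start false (false, 0) (false, 0)) 1 1 by
        rw [unaryRule, if_neg]
        omega)
    rw [Nat.div_one, mul_one] at h
    exact acceptsFrom_iff_of_reaches h.to_reflTransGen
  | succ k ih =>
    have e : 14 ^ (k + 1) * u = 14 * (14 ^ k * u) := by ring
    rw [e] at hv ⊢
    have h := reg_scale (S := unaryMachine M m) (w := w) (q := .strip) (v := 14 * (14 ^ k * u))
      (q' := .strip) (num := 1) (den := 14)
      (by change _ < 210 * _; omega) 
      (show unaryRule M m .strip (14 * (14 ^ k * u) % 210) (decide (14 * (14 ^ k * u) < 210)) =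
          .scale .strip 1 14 by
        rw [unaryRule, if_pos]
        omega)
    rw [Nat.mul_div_cancel_left _ (by norm_num), mul_one] at h
    exact (acceptsFrom_iff_of_reaches h.to_reflTransGen).trans (ih (by omega))

/-- The register content that represents a configuration. -/
def regCode (i j x y : ℕ) : ℕ := 2 ^ i * 3 ^ j * 5 ^ x * 7 ^ y

theorem prime_dvd_prime_pow_iff {p q k : ℕ} (hp : p.Prime) (hq : q.Prime) :
    p ∣ q ^ k ↔ p = q ∧ k ≠ 0 := by
  rcases Nat.eq_zero_or_pos k with rfl | hk
  · simpa using hp.ne_one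
  · rw [hp.prime.dvd_pow_iff_dvd hk.ne', Nat.prime_dvd_prime_iff_eq hp hq]
    simp [hk.ne']

theorem prime_dvd_regCode_iff {p i j x y : ℕ} (hp : p.Prime) :
    p ∣ regCode i j x y ↔
      (p = 2 ∧ i ≠ 0) ∨ (p = 3 ∧ j ≠ 0) ∨ (p = 5 ∧ x ≠ 0) ∨ (p = 7 ∧ y ≠ 0) := by
  rw [regCode, hp.dvd_mul, hp.dvd_mul, hp.dvd_mul, prime_dvd_prime_pow_iff hp Nat.prime_two,
    prime_dvd_prime_pow_iff hp Nat.prime_three, prime_dvd_prime_pow_iff hp Nat.prime_five,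
    prime_dvd_prime_pow_iff hp (by norm_num : Nat.Prime 7), or_assoc, or_assoc]

theorem decide_not_dvd_regCode_mod (i j x y : ℕ) :
    decide (¬ 2 ∣ regCode i j x y % 210) = decide (i = 0) ∧
    decide (¬ 3 ∣ regCode i j x y % 210) = decide (j = 0) ∧
    decide (¬ 5 ∣ regCode i j x y % 210) = decide (x = 0) ∧
    decide (¬ 7 ∣ regCode i j x y % 210) = decide (y = 0) := by
  simp only [decide_eq_decide]
  rw [Nat.dvd_mod_iff (by norm_num), Nat.dvd_mod_iff (by norm_num), Nat.dvd_mod_iff (by norm_num),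
    Nat.dvd_mod_iff (by norm_num), prime_dvd_regCode_iff (by norm_num),
    prime_dvd_regCode_iff (by norm_num), prime_dvd_regCode_iff (by norm_num),
    prime_dvd_regCode_iff (by norm_num)]
  simp

/-- Each of 2 ^ i * 3 ^ j, 5 ^ x and 7 ^ y is at most 3 ^ n, the last two because 5 and 7 are below
9 = 3 ^ 2. -/
theorem regCode_le {n i j x y : ℕ} (h : i + j = n) (hx : 2 * x ≤ n) (hy : 2 * y ≤ n) :
    regCode i j x y ≤ 42 ^ n := by
  have h₁ : 2 ^ i * 3 ^ j ≤ 3 ^ n := by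
    rw [← h, pow_add]
    exact Nat.mul_le_mul (Nat.pow_le_pow_left (by norm_num) _) le_rfl
  have h₂ : ∀ q ≤ 9, ∀ z, 2 * z ≤ n → q ^ z ≤ 3 ^ n := fun q hq z hz =>
    calc q ^ z ≤ 9 ^ z := Nat.pow_le_pow_left hq _
      _ = 3 ^ (2 * z) := by rw [pow_mul]; norm_num
      _ ≤ 3 ^ n := Nat.pow_le_pow_right (by norm_num) hz
  calc regCode i j x y ≤ 3 ^ n * 3 ^ n * 3 ^ n :=
        Nat.mul_le_mul (Nat.mul_le_mul h₁ (h₂ 5 (by norm_num) x hx)) (h₂ 7 (by norm_num) y hy)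
    _ = 27 ^ n := by rw [← mul_pow, ← mul_pow]; norm_num
    _ ≤ 42 ^ n := Nat.pow_le_pow_left (by norm_num) _

/-- In base 2C + 2, (2C + 2) * x ≤ C * (n + 1) < (C + 1) * (n + 1), hence 2 * x < n + 1. -/
theorem two_mul_le_of_abs_decode_le {C n x : ℕ} (d : SignedDigit (2 * C + 1))
    (h : |d.decode x| ≤ (C : ℤ) * (n + 1)) : 2 * x ≤ n := by
  rw [d.abs_decode] at h
  push_cast at h
  by_contra! hlt
  have h₁ : ((C : ℤ) + 1) * (n + 1) ≤ (C + 1) * (2 * x) :=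
    mul_le_mul_of_nonneg_left (by omega) (by omega)
  have h₂ : (0 : ℤ) ≤ (d.2 : ℕ) := by omega
  linarith

/-- A reachable configuration of `M` on the input of length `n`, and its representation. -/
inductive Represents (n : ℕ) : M.Config → (unaryMachine M m).automaton.Config → Prop
  | intro (s : M.State) (e : Bool) (d₀ d₁ : SignedDigit m) (i j x y p : ℕ) (f : Fin 2 → ℤ)
      (reaches : M.Reaches (unaryWord n) ⟨s, p, f⟩) (head : HeadCode n e i j p)
      (counter₀ : f 0 = d₀.decode x) (counter₁ : f 1 = d₁.decode y) :
      Represents n ⟨s, p, f⟩ (unaryReg (.run s e d₀ d₁) (regCode i j x y))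

/-- The counter bound holds only along the computation, which is why `Represents` records
reachability. -/
theorem regCode_lt {C n : ℕ} {M : CounterAutomaton 2 Unit}
    (hC : ∀ c, M.Reaches (unaryWord n) c → ∀ j, |c.counter j| ≤ (C : ℤ) * (n + 1))
    {s : M.State} {e : Bool} {d₀ d₁ : SignedDigit (2 * C + 1)} {i j x y p : ℕ} {f : Fin 2 → ℤ}
    (reaches : M.Reaches (unaryWord n) ⟨s, p, f⟩) (head : HeadCode n e i j p)
    (counter₀ : f 0 = d₀.decode x) (counter₁ : f 1 = d₁.decode y) (hw : w.length = 42 ^ n) :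
    regCode i j x y < 210 * (w.length + 2) := by
  have h₀ : |f 0| ≤ (C : ℤ) * (n + 1) := hC _ reaches 0
  have h₁ : |f 1| ≤ (C : ℤ) * (n + 1) := hC _ reaches 1
  rw [counter₀] at h₀
  rw [counter₁] at h₁
  have h := regCode_le head.sum_eq (two_mul_le_of_abs_decode_le d₀ h₀)
    (two_mul_le_of_abs_decode_le d₁ h₁)
  omega

theorem Represents.step {n : ℕ} {c c' : M.Config} {d : (unaryMachine M m).automaton.Config}
    (h : Represents n c d) (hs : M.Step (unaryWord n) c c')
    (hlt : ∀ s e d₀ d₁ i j x y p f, M.Reaches (unaryWord n) ⟨s, p, f⟩ → HeadCode n e i j p →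
      f 0 = SignedDigit.decode (m := m) d₀ x → f 1 = SignedDigit.decode (m := m) d₁ y →
      regCode i j x y < 210 * (w.length + 2)) :
    ∃ d', Represents n c' d' ∧ Relation.TransGen ((unaryMachine M m).automaton.Step w) d d' := by
  obtain ⟨s, e, d₀, d₁, i, j, x, y, p, f, reaches, head, hf₀, hf₁⟩ := h
  have hreach' := Relation.ReflTransGen.tail reaches hs
  obtain ⟨ha, hr, rfl⟩ := hs
  have hsym := head.tapeSymbolAt_eq (length_unaryWord n)
  have hθ : (fun j => counterStatus (f j)) =
      ![digitStatus d₀ (decide (x = 0)), digitStatus d₁ (decide (y = 0))] := by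
    funext j
    fin_cases j
    · exact hf₀ ▸ counterStatus_decode d₀ x
    · exact hf₁ ▸ counterStatus_decode d₁ y
  obtain ⟨t, ht⟩ : ∃ t, t = M.trans s (scannedSymbol e (decide (i = 0)))
    ![digitStatus d₀ (decide (x = 0)), digitStatus d₁ (decide (y = 0))] := ⟨_, rfl⟩
  have hnext : M.next (unaryWord n) ⟨s, p, f⟩ = ⟨t.1, t.2.1.apply p, fun j => f j + t.2.2 j⟩ := by
    simp only [next, hsym, hθ, ht]
  rw [hnext] at hreach' ⊢
  obtain ⟨i', j', k, head', hk, hk'⟩ := head.move (m := t.2.1)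
    (by
      intro hp hl
      have : scannedSymbol e (decide (i = 0)) = .leftEnd := by rw [← hsym, hp]; rfl
      rw [ht, this] at hl
      exact M.trans_leftEnd _ _ hl)
    (by
      rintro rfl hl
      rw [ht] at hl
      exact M.trans_rightEnd _ _ hl)
  obtain ⟨x', hx, hx'⟩ := d₀.decode_add x (t.2.2 0)
  obtain ⟨y', hy, hy'⟩ := d₁.decode_add y (t.2.2 1)
  obtain ⟨k₅, h₅, h₅'⟩ := exists_pow_eq_factor_mul 5 hx
  obtain ⟨k₇, h₇, h₇'⟩ := exists_pow_eq_factor_mul 7 hy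
  have hlt' := hlt s e d₀ d₁ i j x y p f reaches head hf₀ hf₁
  obtain ⟨e₂, e₃, e₅, e₇⟩ := decide_not_dvd_regCode_mod i j x y
  have hrule : (unaryMachine M m).rule (.run s e d₀ d₁)
      (regCode i j x y % (unaryMachine M m).modulus)
      (decide (regCode i j x y < (unaryMachine M m).modulus)) =
      runRule M m s e d₀ d₁ (decide (i = 0)) (decide (j = 0)) (decide (x = 0)) (decide (y = 0)) := by
    change unaryRule M m (.run s e d₀ d₁) (regCode i j x y % 210)
      (decide (regCode i j x y < 210)) = _
    rw [unaryRule, if_neg ha, if_neg hr, e₂, e₃, e₅, e₇]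
  simp only [runRule, ← ht] at hrule
  refine ⟨_, .intro _ _ _ _ i' j' x' y' _ _ hreach' head' (hf₀ ▸ hx'.symm) (hf₁ ▸ hy'.symm), ?_⟩
  have hgoal := reg_scale (w := w) hlt' hrule
  convert hgoal using 2
  -- The register equals den * (k * k₅ * k₇), so the truncated division of the scaling machine is
  -- exact.
  obtain ⟨den, hden⟩ : ∃ q, q = (headRule e (decide (j = 0)) t.2.1).2.2 *
    downFactor 5 (d₀.add (decide (x = 0)) (t.2.2 0)).2 *
    downFactor 7 (d₁.add (decide (y = 0)) (t.2.2 1)).2 := ⟨_, rfl⟩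
  have e₁ : regCode i j x y = den * (k * k₅ * k₇) := by
    rw [regCode, hk, h₅, h₇, hden]; ring
  have hden₀ : 0 < den := by
    have : 0 < regCode i j x y := by unfold regCode; positivity
    exact Nat.pos_of_mul_pos_right (e₁ ▸ this)
  rw [← hden, e₁, Nat.mul_div_cancel_left _ hden₀, regCode, hk', h₅', h₇']
  ring

/-- The start is represented because 3 ^ n = `regCode 0 n 0 0`: the head is at distance n from the
last letter and both counters are zero. -/
theorem acceptsFrom_run {C n : ℕ} (hC : ∀ c, M.Reaches (unaryWord n) c →
      ∀ j, |c.counter j| ≤ (C : ℤ) * (n + 1)) (hw : w.length = 42 ^ n) :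
    (unaryMachine M (2 * C + 1)).automaton.AcceptsFrom w
        (unaryReg (.run M.start false (false, 0) (false, 0)) (3 ^ n)) ↔
      M.Accepts (unaryWord n) := by
  have hinit : Represents (m := 2 * C + 1) n M.initial
      (unaryReg (.run M.start false (false, 0) (false, 0)) (3 ^ n)) := by
    have := Represents.intro (M := M) (m := 2 * C + 1) (n := n) M.start false (false, 0) (false, 0)
      0 n 0 0 0 (fun _ => 0) .refl ⟨by simp, by simp, by simp⟩ (by simp [SignedDigit.decode])
      (by simp [SignedDigit.decode])
    simpa [regCode, initial] using this
  rw [accepts_iff_acceptsFrom]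
  refine (acceptsFrom_iff_of_simulation (Represents n) ?_ ?_ ?_ hinit).symm
  · exact fun c d c' h hs => h.step hs fun s e d₀ d₁ i j x y p f h₁ h₂ h₃ h₄ =>
      regCode_lt hC h₁ h₂ h₃ h₄ hw
  · rintro _ _ ⟨s, e, d₀, d₁, i, j, x, y, p, f, reaches, head, hf₀, hf₁⟩ ha
    exact acceptsFrom_reg_of_accept (regCode_lt hC reaches head hf₀ hf₁ hw) (if_pos ha)
  · rintro _ _ ⟨s, e, d₀, d₁, i, j, x, y, p, f, reaches, head, hf₀, hf₁⟩ hr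
    refine not_acceptsFrom_reg_of_reject (regCode_lt hC reaches head hf₀ hf₁ hw) ?_
    obtain rfl : s = M.reject := hr
    exact (if_neg M.accept_ne_reject.symm).trans (if_pos rfl)

end CounterAutomaton

/-! ### The general theorem and its two applications -/

theorem recognizedBy2D1CA_of_linearlyBounded {L : Language Unit}
    (hL : RecognizedByLinearlyBounded2D2CA L) :
    RecognizedBy2D1CA
      ({w | ∃ n : ℕ, unaryWord n ∈ L ∧ w = unaryWord (42 ^ n)} : Language Unit) := by
  obtain ⟨M, ⟨C, hC⟩, hM⟩ := hL
  refine ⟨(M.unaryMachine (2 * C + 1)).automaton, fun w => ?_⟩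
  have hiff : ∀ n, w.length = 42 ^ n →
      ((M.unaryMachine (2 * C + 1)).automaton.AcceptsFrom w
        (CounterAutomaton.unaryReg .strip w.length) ↔ unaryWord n ∈ L) := by
    intro n hn
    -- As 3 ^ n is odd, stripping removes exactly the n factors 14.
    have h₁ : w.length = 14 ^ n * 3 ^ n := by rw [hn, ← mul_pow]; norm_num
    have h₂ : ¬ 14 ∣ 3 ^ n := fun h => by
      have := Nat.prime_two.dvd_of_dvd_pow ((show 2 ∣ 14 by norm_num).trans h)
      omega
    have h₃ := CounterAutomaton.acceptsFrom_strip (M := M) (m := 2 * C + 1) h₂ n h₁.ge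
    rw [← h₁] at h₃
    rw [h₃, CounterAutomaton.acceptsFrom_run
      (fun c hc j => by simpa using hC (unaryWord n) c hc j) hn, hM]
  rw [ScalingMachine.accepts_iff]
  refine Iff.trans ?_ (CounterAutomaton.acceptsFrom_check w.length le_rfl).symm
  constructor
  · rintro ⟨n, hn, hw⟩
    have hw := eq_unaryWord_iff.1 hw
    exact ⟨⟨n, hw⟩, (hiff n hw).2 hn⟩
  · rintro ⟨⟨n, hw⟩, h⟩
    exact ⟨n, (hiff n hw).1 h, eq_unaryWord_iff.2 hw⟩

theorem theorem1 :
    (∀ L : Language Unit, RecognizedByLinearlyBounded2D2CA L →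
      RecognizedBy2D1CA ({w | ∃ n : ℕ, unaryWord n ∈ L ∧ w = unaryWord (42 ^ n)} : Language Unit)) ∧
    RecognizedBy2D1CA ({w | ∃ n : ℕ, w = unaryWord (42 ^ (n ^ 2))} : Language Unit) ∧
    RecognizedBy2D1CA ({w | ∃ p : ℕ, p.Prime ∧ w = unaryWord (42 ^ p)} : Language Unit) := by
  refine ⟨fun L => recognizedBy2D1CA_of_linearlyBounded, ?_, ?_⟩
  · obtain ⟨M, hM⟩ :=
      recognizedBy2D1CA_of_linearlyBounded recognizedByLinearlyBounded2D2CA_squares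
    refine ⟨M, fun w => Iff.trans ?_ (hM w)⟩
    constructor
    · rintro ⟨n, hw⟩
      exact ⟨n ^ 2, ⟨n, rfl⟩, hw⟩
    · rintro ⟨_, ⟨n, hn⟩, hw⟩
      rw [eq_unaryWord_iff, length_unaryWord] at hn
      exact ⟨n, hn ▸ hw⟩
  · obtain ⟨M, hM⟩ :=
      recognizedBy2D1CA_of_linearlyBounded recognizedByLinearlyBounded2D2CA_primes
    refine ⟨M, fun w => Iff.trans ?_ (hM w)⟩
    constructor
    · rintro ⟨p, hp, hw⟩
      exact ⟨p, ⟨p, hp, rfl⟩, hw⟩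
    · rintro ⟨_, ⟨p, hp, hn⟩, hw⟩
      rw [eq_unaryWord_iff, length_unaryWord] at hn
      exact ⟨p, hp, hn ▸ hw⟩
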